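/- Let $X$ be a Whitney stratified manifold: a smooth (Hausdorff, second countable) manifold with a locally finite partition into connected, locally closed, smooth submanifolds (the strata), which satisfies the frontier condition ($A\cap\overline{B}\neq\emptyset\Rightarrow A\subseteq\overline{B}$ for strata $A,B$) and Whitney's condition B. Let $\star\in X$ be a basepoint lying in an open stratum. A smooth map $f:S^n\to X$ is transversal if $T_pS^n\to T_{f(p)}X/T_{f(p)}A$ is surjective whenever $f(p)$ lies in the stratum $A$. Fix a closed disk $B^n\subset S^n$ about the basepoint of $S^n$. For $n\ge 1$ let $\psi_n(X)$ be the set of classes $[f]$ of smooth transversal maps $f:(S^n,B^n)\to(X,\star)$ modulo homotopy through such maps (smooth homotopies $S^n\times[0,1]\to X$, constant in $t$ near $t=0$ and near $t=1$). It carries the product $[f][g]=[(f\vee g)\circ\mu]$, where $\mu:(S^n,B^n)\to(S^n\vee S^n,\star)$ is a fixed orientation-preserving pinch map (a smooth map which is a diffeomorphism over $(S^n-B^n)\sqcup(S^n-B^n)$), the unit $1$, which is the class of the constant map to $\star$, and the operation $[f]^\dagger=[f\circ\rho]$, where $\rho$ is a reflection of $S^n$ in a hyperplane through the basepoint. The stratification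 of $S^n$ induced by $f$ is the decomposition of $S^n$ into the nonempty preimages $f^{-1}(A)$ of the strata $A$ of $X$; it is trivial if $S^n$ is its only member. Then for every $n\ge 1$ the following hold. (1) For every such $X$ and every $[f]\in\psi_n(X)$, the element $[f]$ is invertible if and only if the stratification of $S^n$ induced by $f$ is trivial. (2) For every such $X$ and all $a,b\in\psi_n(X)$, if $ab=1$ then $b=a^\dagger$. In particular every invertible element $a$ is unitary: $aa^\dagger=1=a^\dagger a$. (3) $\psi_n(X)$ is in general not a group: there is a based Whitney stratified manifold $X$ such that $\psi_n(X)$ has a non-invertible element. -/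

import Mathlib

open Set Filter Topology Manifold
open scoped ContDiff

namespace TransversalHomotopy

noncomputable section

/-! ## Whitney stratified manifolds

A smooth manifold of dimension `m` is a second countable Hausdorff space `X` with
`[ChartedSpace (EuclideanSpace ℝ (Fin m)) X]` and `[IsManifold (𝓡 m) ∞ X]`. -/

section Strat

variable {m : ℕ} {X : Type*} [TopologicalSpace X] [ChartedSpace (EuclideanSpace ℝ (Fin m)) X]

variable (m) in
/-- `A ⊆ X` is a (smooth, embedded) submanifold: near each of its points it is a linear subspace
in some chart of the smooth structure. -/
def IsSubmanifold (A : Set X) : Prop :=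
  ∀ p ∈ A, ∃ φ ∈ IsManifold.maximalAtlas (𝓡 m) ∞ X, p ∈ φ.source ∧
    ∃ V : Submodule ℝ (EuclideanSpace ℝ (Fin m)), ∀ x ∈ φ.source, x ∈ A ↔ φ x ∈ V

/-- The velocities at `p` of smooth curves `γ : (-ε, ε) → X` with `γ 0 = p` running inside `A`. -/
def velocities (A : Set X) (p : X) : Set (TangentSpace (𝓡 m) p) :=
  {v | ∃ γ : ℝ → X, ∃ ε > 0, ContMDiffOn 𝓘(ℝ, ℝ) (𝓡 m) ∞ γ (Ioo (-ε) ε) ∧ γ 0 = p ∧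
    (∀ t ∈ Ioo (-ε) ε, γ t ∈ A) ∧ mfderiv 𝓘(ℝ, ℝ) (𝓡 m) γ 0 (1 : ℝ) = v}

/-- The tangent space `T_p A ⊆ T_p X` of a submanifold `A` at `p ∈ A`. (The velocities of curves
in a submanifold already form a subspace, so that the span adds nothing.) -/
def tangentSubspace (A : Set X) (p : X) : Submodule ℝ (TangentSpace (𝓡 m) p) :=
  Submodule.span ℝ (velocities A p)

/-- The tangent space `T_y A`, seen in the preferred chart at `x` (for `y` near `x`). -/
def tangentInChart (A : Set X) (x y : X) : Submodule ℝ (EuclideanSpace ℝ (Fin m)) :=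
  (tangentSubspace (m := m) A y).map
    (mvfderiv (𝓡 m) (extChartAt (𝓡 m) x) y).toLinearMap

/-- The secant line through `y` and `z`, seen in the preferred chart at `x`. -/
def secantInChart (x y z : X) : Submodule ℝ (EuclideanSpace ℝ (Fin m)) :=
  Submodule.span ℝ {extChartAt (𝓡 m) x z - extChartAt (𝓡 m) x y}

/-- Convergence of a sequence of subspaces of `ℝᵐ` in the disjoint union of the Grassmannians, i.e.
convergence of the orthogonal projections onto them. -/
def SubspaceTendsto (V : ℕ → Submodule ℝ (EuclideanSpace ℝ (Fin m)))
    (P : Submodule ℝ (EuclideanSpace ℝ (Fin m))) : Prop :=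
  Tendsto (fun k => (V k).starProjection) atTop (𝓝 P.starProjection)

variable (m) in
/-- Whitney's condition B for the pair `(A, B)` at the point `x` of `A`: whenever `a k ∈ A` and
`b k ∈ B` converge to `x`, the secant lines through `a k` and `b k` converge to a line `L`, and the
tangent spaces `T_(b k) B` converge to `P`, then `L ⊆ P`. -/
def WhitneyB (A B : Set X) (x : X) : Prop :=
  ∀ (a b : ℕ → X), (∀ k, a k ∈ A) → (∀ k, b k ∈ B) →
    Tendsto a atTop (𝓝 x) → Tendsto b atTop (𝓝 x) →
    ∀ L P : Submodule ℝ (EuclideanSpace ℝ (Fin m)), Module.finrank ℝ L = 1 →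
      SubspaceTendsto (fun k => secantInChart x (a k) (b k)) L →
      SubspaceTendsto (fun k => tangentInChart B x (b k)) P → L ≤ P

variable (m) in
/-- A Whitney stratification of the manifold `X`, given by its set of strata. The partial order on
the strata is `A ≤ B ↔ A ⊆ closure B`. -/
structure IsWhitneyStratification (𝒮 : Set (Set X)) : Prop where
  partition : Setoid.IsPartition 𝒮
  locallyFinite : LocallyFinite (fun A : 𝒮 => (A : Set X))
  frontier : ∀ A ∈ 𝒮, ∀ B ∈ 𝒮, (A ∩ closure B).Nonempty → A ⊆ closure B
  connected : ∀ A ∈ 𝒮, IsConnected A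
  locallyClosed : ∀ A ∈ 𝒮, IsLocallyClosed A
  submanifold : ∀ A ∈ 𝒮, IsSubmanifold m A
  whitneyB : ∀ A ∈ 𝒮, ∀ B ∈ 𝒮, A ⊆ closure B → ∀ x ∈ A, WhitneyB m A B x

variable (m X) in
/-- The structure of a based Whitney stratified manifold on the manifold `X`. The basepoint is
generic: it lies in an open stratum. -/
structure BasedWhitney where
  strata : Set (Set X)
  isWhitney : IsWhitneyStratification m strata
  pt : X
  generic : ∃ A ∈ strata, pt ∈ A ∧ IsOpen A

/-- A smooth map `f : M → X` from a manifold is transversal to the strata in `𝒮` if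
`T_p M → T_(f p) X → T_(f p) X / T_(f p) A` is surjective whenever `f p` lies in the stratum `A`. -/
def IsTransversal (n m : ℕ) {X : Type*} [TopologicalSpace X]
    [ChartedSpace (EuclideanSpace ℝ (Fin m)) X] {M : Type*} [TopologicalSpace M]
    [ChartedSpace (EuclideanSpace ℝ (Fin n)) M] (𝒮 : Set (Set X)) (f : M → X) : Prop :=
  ∀ p : M, ∀ A ∈ 𝒮, f p ∈ A →
    Function.Surjective fun v : TangentSpace (𝓡 n) p =>
      (tangentSubspace (m := m) A (f p)).mkQ (mfderiv (𝓡 n) (𝓡 m) f p v)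

/-- The decomposition of `M` induced by a map `f : M → X` (`M` being trivially stratified): its
members are the nonempty preimages of strata. -/
def inducedStratification {M : Type*} (𝒮 : Set (Set X)) (f : M → X) : Set (Set M) :=
  {C | C.Nonempty ∧ ∃ A ∈ 𝒮, C = f ⁻¹' A}

/-- The trivial stratification has the whole space as its only stratum. -/
def IsTrivialStratification {M : Type*} (𝒮 : Set (Set M)) : Prop := 𝒮 = {univ}

theorem tangentSubspace_eq_top [IsManifold (𝓡 m) ∞ X] {A : Set X} (hA : IsOpen A) {p : X}
    (hp : p ∈ A) : tangentSubspace (m := m) A p = ⊤ := by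
  rw [eq_top_iff]
  intro v _
  refine Submodule.subset_span ?_
  set φ := extChartAt (𝓡 m) p with hφ
  set w : EuclideanSpace ℝ (Fin m) := mfderiv (𝓡 m) 𝓘(ℝ, EuclideanSpace ℝ (Fin m)) φ p v with hw
  set c : ℝ → EuclideanSpace ℝ (Fin m) := fun t => φ p + t • w with hc
  have hcs : ContDiff ℝ ∞ c := by fun_prop
  have hT : φ.target ∈ 𝓝 (c 0) := by
    simp only [hc, zero_smul, add_zero]
    exact extChartAt_target_mem_nhds p
  have hAn : φ.symm ⁻¹' A ∈ 𝓝 (c 0) := by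
    simp only [hc, zero_smul, add_zero]
    refine (continuousAt_extChartAt_symm p).preimage_mem_nhds ?_
    rw [extChartAt_to_inv]
    exact hA.mem_nhds hp
  have hnear := hcs.continuous.continuousAt.preimage_mem_nhds (inter_mem hT hAn)
  obtain ⟨ε, hε, hsub⟩ := Metric.mem_nhds_iff.1 hnear
  have hI : ∀ t ∈ Ioo (-ε) ε, c t ∈ φ.target ∧ φ.symm (c t) ∈ A := by
    intro t ht
    have : t ∈ Metric.ball (0 : ℝ) ε := by
      rw [Metric.mem_ball, Real.dist_eq, sub_zero, abs_lt]; exact ht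
    exact hsub this
  refine ⟨fun t => φ.symm (c t), ε, hε, ?_, ?_, fun t ht => (hI t ht).2, ?_⟩
  · exact (contMDiffOn_extChartAt_symm p).comp hcs.contMDiff.contMDiffOn fun t ht => (hI t ht).1
  · simp only [hc, zero_smul, add_zero]
    exact extChartAt_to_inv p
  · have h0 : c 0 = φ p := by simp [hc]
    have hsymm : MDifferentiableAt 𝓘(ℝ, EuclideanSpace ℝ (Fin m)) (𝓡 m) φ.symm (c 0) := by
      have := (contMDiffOn_extChartAt_symm (I := 𝓡 m) (n := ∞) p).contMDiffAt hT
      exact this.mdifferentiableAt (by simp)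
    have hcd : MDifferentiableAt 𝓘(ℝ, ℝ) 𝓘(ℝ, EuclideanSpace ℝ (Fin m)) c 0 :=
      hcs.contMDiff.mdifferentiableAt (by simp)
    have h1 : mfderiv 𝓘(ℝ, ℝ) (𝓡 m) (fun t => φ.symm (c t)) 0 =
        (mfderiv 𝓘(ℝ, EuclideanSpace ℝ (Fin m)) (𝓡 m) φ.symm (c 0)).comp
          (mfderiv 𝓘(ℝ, ℝ) 𝓘(ℝ, EuclideanSpace ℝ (Fin m)) c 0) :=
      mfderiv_comp 0 hsymm hcd
    have h2 : mfderiv 𝓘(ℝ, ℝ) 𝓘(ℝ, EuclideanSpace ℝ (Fin m)) c 0 (1 : ℝ) = w := by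
      have : HasDerivAt c w 0 := by
        have := ((hasDerivAt_id (0 : ℝ)).smul_const w).const_add (φ p)
        rw [one_smul] at this
        exact this
      rw [mfderiv_eq_fderiv]
      exact this.deriv
    have h3 := mfderivWithin_extChartAt_symm_comp_mfderiv_extChartAt' (I := 𝓡 m) (x := p)
      (y := p) (mem_extChartAt_source p)
    have h4 := congrArg (fun T => T v) h3
    simp only [modelWithCornersSelf_coe, range_id, mfderivWithin_univ] at h4
    rw [h1]
    change mfderiv 𝓘(ℝ, EuclideanSpace ℝ (Fin m)) (𝓡 m) φ.symm (c 0)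
      (mfderiv 𝓘(ℝ, ℝ) 𝓘(ℝ, EuclideanSpace ℝ (Fin m)) c 0 (1 : ℝ)) = v
    rw [h2, h0]
    exact h4

end Strat

/-! ## The sphere, its basepoint and the pinch map -/

/-- The unit sphere `Sⁿ` in `ℝⁿ⁺¹`. -/
abbrev Sph (n : ℕ) : Type := Metric.sphere (0 : EuclideanSpace ℝ (Fin (n + 1))) 1

/-- The last coordinate. -/
def height {n : ℕ} (x : Sph n) : ℝ := x.1 (Fin.last n)

/-- The basepoint `⋆` of `Sⁿ`, with last coordinate `1`. -/
def pole (n : ℕ) : Sph n := ⟨EuclideanSpace.single (Fin.last n) 1, by simp⟩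

/-- The closed disk `Bⁿ ⊆ Sⁿ` about the basepoint. In stereographic coordinates
`Sⁿ \ {⋆} ≃ ℝⁿ` it is the set `‖y‖ ≥ 2`. -/
def cap (n : ℕ) : Set (Sph n) := {x | 3 / 5 ≤ height x}

theorem sph_sq {n : ℕ} (x : Sph (n + 1)) : x.1 0 ^ 2 + height x ^ 2 ≤ 1 := by
  have h : ‖x.1‖ = 1 := by simp
  have h2 : ∑ i, (x.1 i) ^ 2 = 1 := by
    rw [← EuclideanSpace.real_norm_sq_eq, h]; norm_num
  have := Finset.sum_le_sum_of_subset_of_nonneg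
    (Finset.subset_univ ({0, Fin.last (n + 1)} : Finset (Fin (n + 2))))
    (f := fun i => (x.1 i) ^ 2) (fun i _ _ => sq_nonneg _)
  rw [Finset.sum_pair (by simp [Fin.ext_iff]), h2] at this
  exact this

theorem sph_norm {n : ℕ} (x : Sph n) : ‖x.1‖ = 1 := by simp

/-- The squared norm of the stereographic image of `x` under `y ↦ a y + c e₀`, times
`1 - height x`. -/
def simNum {n : ℕ} (a c : ℝ) (x : Sph (n + 1)) : ℝ :=
  a ^ 2 * (1 + height x) + 2 * a * c * x.1 0 + c ^ 2 * (1 - height x)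

theorem simNum_pos {n : ℕ} {a c : ℝ} (ha : a ≠ 0) (x : Sph (n + 1)) :
    0 < simNum a c x + (1 - height x) := by
  have h := sph_sq x
  have hs : height x ≤ 1 := by nlinarith [sq_nonneg (x.1 0)]
  have ha2 : 0 < a ^ 2 := by positivity
  rcases eq_or_lt_of_le hs with h1 | h1
  · have h0 : x.1 0 = 0 := by nlinarith [sq_nonneg (x.1 0)]
    simp only [simNum, h1, h0]; nlinarith
  · have : 0 ≤ simNum a c x * (1 - height x) := by
      unfold simNum
      nlinarith [sq_nonneg (a * x.1 0 + c * (1 - height x))]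
    have : 0 ≤ simNum a c x := nonneg_of_mul_nonneg_left this (by linarith)
    linarith

/-- The vector underlying `similarity`. -/
def simVec {n : ℕ} (a c : ℝ) (x : Sph (n + 1)) : EuclideanSpace ℝ (Fin (n + 2)) :=
  (simNum a c x + (1 - height x))⁻¹ •
    ((2 * a) • x.1 + (2 * c * (1 - height x)) • EuclideanSpace.single 0 1 +
      (simNum a c x - (1 - height x) - 2 * a * height x) •
        EuclideanSpace.single (Fin.last (n + 1)) 1)

theorem simVec_norm {n : ℕ} {a c : ℝ} (ha : a ≠ 0) (x : Sph (n + 1)) : ‖simVec a c x‖ = 1 := by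
  have hD := simNum_pos (c := c) ha x
  have hn : ∑ i, (x.1 i) ^ 2 = 1 := by
    rw [← EuclideanSpace.real_norm_sq_eq, sph_norm]; norm_num
  rw [← sq_eq_sq₀ (norm_nonneg _) zero_le_one, EuclideanSpace.real_norm_sq_eq,
    Fin.sum_univ_succ, Fin.sum_univ_castSucc]
  rw [Fin.sum_univ_succ, Fin.sum_univ_castSucc] at hn
  have hl : Fin.succ (Fin.last n) = Fin.last (n + 1) := rfl
  simp only [simVec, PiLp.smul_apply, PiLp.add_apply, smul_eq_mul, PiLp.single_apply,
    hl, Fin.ext_iff, Fin.val_zero, Fin.val_last, Fin.val_succ, Fin.val_castSucc] at hn ⊢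
  have e1 : ∀ i : Fin n, ((i : ℕ) + 1 = n + 1) = False := fun i => by
    simp only [eq_iff_iff, iff_false]; omega
  simp only [e1, if_false, Nat.add_eq_zero_iff, one_ne_zero, and_false, if_true, mul_zero, mul_one, add_zero,
    (Nat.succ_ne_zero n).symm, mul_pow, inv_pow, ← Finset.mul_sum]
  have hs : x.1 (Fin.last (n + 1)) = height x := rfl
  rw [hs] at hn ⊢
  have hn' : ∑ i : Fin n, (x.1 (i.castSucc.succ)) ^ 2 = 1 - height x ^ 2 - x.1 0 ^ 2 := by
    linarith
  rw [hn']
  field_simp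
  simp only [simNum]
  ring

/-- The diffeomorphism of the sphere which fixes the basepoint and is the similarity
`y ↦ a y + c e₀` in the stereographic coordinates `y = (x₀, …, xₙ) / (1 - xₙ₊₁)` on the complement
of the basepoint. -/
def similarity {n : ℕ} (a c : ℝ) (ha : a ≠ 0) (x : Sph (n + 1)) : Sph (n + 1) :=
  ⟨simVec a c x, by simpa using simVec_norm ha x⟩

/-- The vector underlying `collapse`. -/
def collapseVec {n : ℕ} (x : Sph n) : EuclideanSpace ℝ (Fin (n + 1)) :=
  (1 - Real.smoothTransition (5 * height x - 3)) • x.1 +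
    Real.smoothTransition (5 * height x - 3) • (pole n).1

theorem collapseVec_ne_zero {n : ℕ} (x : Sph n) : collapseVec x ≠ 0 := by
  intro h
  have h0 := Real.smoothTransition.nonneg (5 * height x - 3)
  have h1 := Real.smoothTransition.le_one (5 * height x - 3)
  rcases h0.eq_or_lt with h2 | h2
  · rw [collapseVec, ← h2] at h
    have := sph_norm x
    rw [sub_zero, one_smul, zero_smul, add_zero] at h
    simp [h] at this
  · have h3 : 0 < 5 * height x - 3 := by
      by_contra hc
      rw [Real.smoothTransition.zero_of_nonpos (not_lt.1 hc)] at h2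
      exact lt_irrefl _ h2
    have h4 := congrArg (fun v => v (Fin.last n)) h
    have hs : x.1 (Fin.last n) = height x := rfl
    simp only [collapseVec, pole, PiLp.add_apply, PiLp.smul_apply, smul_eq_mul, hs,
      PiLp.single_apply, if_true, PiLp.zero_apply] at h4
    nlinarith

/-- A smooth map `Sⁿ → Sⁿ` which is the identity outside the disk `Bⁿ`, maps `Bⁿ` to itself and is
constant with value `⋆` where the last coordinate is at least `4 / 5`: it moves `x` towards `⋆`. -/
def collapse {n : ℕ} (x : Sph n) : Sph n :=
  ⟨‖collapseVec x‖⁻¹ • collapseVec x, by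
    simp [norm_smul, collapseVec_ne_zero x]⟩

/-- The wedge `Sⁿ ∨ Sⁿ`, as the subspace of `Sⁿ × Sⁿ` of pairs with a coordinate equal to `⋆`. -/
def Wedge (n : ℕ) : Type := {p : Sph n × Sph n // p.1 = pole n ∨ p.2 = pole n}

/-- The map `f ∨ g` on the wedge, for based maps `f` and `g`. -/
def wedgeMap {n : ℕ} {X : Type*} (f g : Sph n → X) (p : Wedge n) : X :=
  open Classical in if p.1.2 = pole n then f p.1.1 else g p.1.2

/-- In stereographic coordinates, the similarity `y ↦ 3 (y + e₀)`, which maps the ball of radius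
`2 / 3` about `-e₀` to the complement of the disk `B`. -/
def leftLobe {n : ℕ} : Sph (n + 1) → Sph (n + 1) := similarity 3 3 (by norm_num)

/-- In stereographic coordinates, the similarity `y ↦ 3 (y - e₀)`, which maps the ball of radius
`2 / 3` about `e₀` to the complement of the disk `B`. -/
def rightLobe {n : ℕ} : Sph (n + 1) → Sph (n + 1) := similarity 3 (-3) (by norm_num)

theorem collapse_eq_pole {n : ℕ} {x : Sph n} (h : 4 / 5 ≤ height x) : collapse x = pole n := by
  have h1 : Real.smoothTransition (5 * height x - 3) = 1 :=
    Real.smoothTransition.one_of_one_le (by linarith)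
  have h2 : collapseVec x = (pole n).1 := by simp [collapseVec, h1]
  apply Subtype.ext
  simp [collapse, h2]

theorem collapse_eq_self {n : ℕ} {x : Sph n} (h : height x ≤ 3 / 5) : collapse x = x := by
  have h1 : Real.smoothTransition (5 * height x - 3) = 0 :=
    Real.smoothTransition.zero_of_nonpos (by linarith)
  have h2 : collapseVec x = x.1 := by simp [collapseVec, h1]
  apply Subtype.ext
  simp [collapse, h2]

theorem height_le_one {n : ℕ} (x : Sph n) : height x ≤ 1 := by
  have h := PiLp.norm_apply_le x.1 (Fin.last n)
  rw [sph_norm] at h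
  exact (le_abs_self _).trans h

theorem neg_one_le_height {n : ℕ} (x : Sph n) : -1 ≤ height x := by
  have h := PiLp.norm_apply_le x.1 (Fin.last n)
  rw [sph_norm] at h
  exact (abs_le.1 h).1

theorem collapse_mem_cap {n : ℕ} {x : Sph n} (h : x ∈ cap n) : collapse x ∈ cap n := by
  have h0 := Real.smoothTransition.nonneg (5 * height x - 3)
  have h1 := Real.smoothTransition.le_one (5 * height x - 3)
  have hx : (3 : ℝ) / 5 ≤ height x := h
  have hx1 := height_le_one x
  have hpos : 0 < ‖collapseVec x‖ := norm_pos_iff.2 (collapseVec_ne_zero x)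
  have hle : ‖collapseVec x‖ ≤ 1 := by
    refine (norm_add_le _ _).trans ?_
    rw [norm_smul, norm_smul, sph_norm, sph_norm, Real.norm_of_nonneg h0,
      Real.norm_of_nonneg (by linarith)]
    linarith
  have hl : collapseVec x (Fin.last n) = (1 - Real.smoothTransition (5 * height x - 3)) * height x
      + Real.smoothTransition (5 * height x - 3) := by
    simp [collapseVec, pole, height]
  have hv : (3 : ℝ) / 5 ≤ collapseVec x (Fin.last n) := by rw [hl]; nlinarith
  change (3 : ℝ) / 5 ≤ ‖collapseVec x‖⁻¹ * collapseVec x (Fin.last n)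
  have : 1 ≤ ‖collapseVec x‖⁻¹ := (one_le_inv₀ hpos).2 hle
  nlinarith

theorem height_similarity {n : ℕ} {a c : ℝ} (ha : a ≠ 0) (x : Sph (n + 1)) :
    height (similarity a c ha x) =
      (simNum a c x - (1 - height x)) / (simNum a c x + (1 - height x)) := by
  have h0 : Fin.last (n + 1) ≠ 0 := by simp [Fin.ext_iff]
  have hs : x.1 (Fin.last (n + 1)) = height x := rfl
  simp only [height, similarity, simVec, PiLp.smul_apply, PiLp.add_apply, smul_eq_mul,
    PiLp.single_apply, h0, if_false, if_true]
  rw [hs, div_eq_inv_mul]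
  ring

theorem le_height_similarity {n : ℕ} {c : ℝ} (hc : c ^ 2 = 9) (x : Sph (n + 1))
    (h : 1 - height x ≤ 2 * (1 + c / 3 * x.1 0)) :
    4 / 5 ≤ height (similarity 3 c (by norm_num) x) := by
  rw [height_similarity, le_div_iff₀ (simNum_pos (by norm_num) x)]
  simp only [simNum, hc]
  linarith

theorem pinch_mem {n : ℕ} (x : Sph (n + 1)) :
    collapse (leftLobe x) = pole (n + 1) ∨ collapse (rightLobe x) = pole (n + 1) := by
  rcases le_total 0 (x.1 0) with h | h
  · exact Or.inl (collapse_eq_pole (le_height_similarity (by norm_num) x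
      (by linarith [neg_one_le_height x])))
  · exact Or.inr (collapse_eq_pole (le_height_similarity (by norm_num) x
      (by linarith [neg_one_le_height x])))

/-- The pinch map `μ : (Sⁿ, Bⁿ) → (Sⁿ ∨ Sⁿ, ⋆)`, for `n ≥ 1`. Over `(Sⁿ - Bⁿ) + (Sⁿ - Bⁿ)` it is a
diffeomorphism, given on two disjoint balls in `Sⁿ - Bⁿ` by similarities in stereographic
coordinates. -/
def pinch {n : ℕ} (x : Sph (n + 1)) : Wedge (n + 1) :=
  ⟨(collapse (leftLobe x), collapse (rightLobe x)), pinch_mem x⟩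

/-- The vector underlying `reflect`. -/
def reflectVec {n : ℕ} (x : Sph (n + 1)) : EuclideanSpace ℝ (Fin (n + 2)) :=
  x.1 - (2 * x.1 0) • EuclideanSpace.single 0 1

theorem reflectVec_norm {n : ℕ} (x : Sph (n + 1)) : ‖reflectVec x‖ = 1 := by
  rw [← sq_eq_sq₀ (norm_nonneg _) zero_le_one, EuclideanSpace.real_norm_sq_eq, one_pow]
  have hn : ∑ i, (x.1 i) ^ 2 = 1 := by
    rw [← EuclideanSpace.real_norm_sq_eq, sph_norm]; norm_num
  rw [← hn]
  refine Finset.sum_congr rfl fun i _ => ?_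
  by_cases hi : i = 0
  · subst hi; simp [reflectVec]; ring
  · simp [reflectVec, hi]

/-- The reflection `ρ` of `Sⁿ` (`n ≥ 1`) in the hyperplane `x₀ = 0`, which contains `⋆`. -/
def reflect {n : ℕ} (x : Sph (n + 1)) : Sph (n + 1) :=
  ⟨reflectVec x, by simpa using reflectVec_norm x⟩

/-! ## Transversal homotopy monoids -/

section Psi

variable {m : ℕ} {X : Type*} [TopologicalSpace X] [ChartedSpace (EuclideanSpace ℝ (Fin m)) X]

/-- A smooth transversal map `(Sⁿ, Bⁿ) → (X, ⋆)`. -/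
structure TransversalMap (S : BasedWhitney m X) (n : ℕ) where
  toFun : Sph n → X
  smooth : ContMDiff (𝓡 n) (𝓡 m) ∞ toFun
  transversal : IsTransversal n m S.strata toFun
  based : ∀ x ∈ cap n, toFun x = S.pt

/-- Homotopy through smooth transversal maps `(Sⁿ, Bⁿ) → (X, ⋆)`. The homotopy is required to be
constant in `t` near the ends `t = 0` and `t = 1` of the unit interval; it is extended to all `t : ℝ`
by these constants. -/
def Homotopic {S : BasedWhitney m X} {n : ℕ} (f g : TransversalMap S n) : Prop :=
  ∃ H : Sph n → ℝ → X,
    ContMDiff ((𝓡 n).prod 𝓘(ℝ, ℝ)) (𝓡 m) ∞ (fun p : Sph n × ℝ => H p.1 p.2) ∧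
    (∀ t, IsTransversal n m S.strata fun x => H x t) ∧
    (∀ t, ∀ x ∈ cap n, H x t = S.pt) ∧
    ∃ ε > 0, (∀ t < ε, ∀ x, H x t = f.toFun x) ∧ (∀ t > 1 - ε, ∀ x, H x t = g.toFun x)

theorem Homotopic.refl {S : BasedWhitney m X} {n : ℕ} (f : TransversalMap S n) :
    Homotopic f f :=
  ⟨fun x _ => f.toFun x, f.smooth.comp contMDiff_fst, fun _ => f.transversal,
    fun _ => f.based, 1, one_pos, fun _ _ _ => rfl, fun _ _ _ => rfl⟩

theorem Homotopic.symm {S : BasedWhitney m X} {n : ℕ} {f g : TransversalMap S n}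
    (h : Homotopic f g) : Homotopic g f := by
  obtain ⟨H, h1, h2, h3, ε, hε, h4, h5⟩ := h
  refine ⟨fun x t => H x (1 - t), ?_, fun t => h2 _, fun t => h3 _, ε, hε,
    fun t ht x => h5 _ (by linarith) x, fun t ht x => h4 _ (by linarith) x⟩
  have hs : ContMDiff 𝓘(ℝ, ℝ) 𝓘(ℝ, ℝ) ∞ fun t : ℝ => 1 - t :=
    ContDiff.contMDiff (by fun_prop)
  exact h1.comp (contMDiff_fst.prodMk (hs.comp contMDiff_snd))

theorem Homotopic.trans {S : BasedWhitney m X} {n : ℕ} {f g k : TransversalMap S n}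
    (h : Homotopic f g) (h' : Homotopic g k) : Homotopic f k := by
  obtain ⟨H, h1, h2, h3, ε, hε, h4, h5⟩ := h
  obtain ⟨K, k1, k2, k3, δ, hδ, k4, k5⟩ := h'
  classical
  have e1 : ∀ x, ∀ t : ℝ, t ≤ 1 / 2 → (if t ≤ 1 / 2 then H x (2 * t) else K x (2 * t - 1)) =
      H x (2 * t) := fun x t ht => if_pos ht
  have e2 : ∀ x, ∀ t : ℝ, 1 / 2 < t → (if t ≤ 1 / 2 then H x (2 * t) else K x (2 * t - 1)) =
      K x (2 * t - 1) := fun x t ht => if_neg (not_le.2 ht)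
  refine ⟨fun x t => if t ≤ 1 / 2 then H x (2 * t) else K x (2 * t - 1), ?_, fun t => ?_,
    fun t x hx => ?_, min (min ε δ / 2) (1 / 4), by positivity, fun t ht x => ?_,
    fun t ht x => ?_⟩
  · have s1 : ContMDiff 𝓘(ℝ, ℝ) 𝓘(ℝ, ℝ) ∞ fun t : ℝ => 2 * t := ContDiff.contMDiff (by fun_prop)
    have s2 : ContMDiff 𝓘(ℝ, ℝ) 𝓘(ℝ, ℝ) ∞ fun t : ℝ => 2 * t - 1 :=
      ContDiff.contMDiff (by fun_prop)
    have t1 := h1.comp (contMDiff_fst.prodMk (s1.comp (contMDiff_snd (I := 𝓡 n) (M := Sph n))))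
    have t2 := k1.comp (contMDiff_fst.prodMk (s2.comp (contMDiff_snd (I := 𝓡 n) (M := Sph n))))
    rintro ⟨x, t⟩
    have hc : ContinuousAt (fun p : Sph n × ℝ => p.2) (x, t) := continuousAt_snd
    rcases lt_trichotomy t (1 / 2) with ht | ht | ht
    · refine (t1 (x, t)).congr_of_eventuallyEq ?_
      filter_upwards [hc.preimage_mem_nhds (Iio_mem_nhds ht)] with p hp
      exact e1 _ _ (le_of_lt hp)
    · refine ((g.smooth.comp contMDiff_fst) (x, t)).congr_of_eventuallyEq ?_
      filter_upwards [hc.preimage_mem_nhds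
        (Ioo_mem_nhds (a := 1 / 2 - ε / 2) (b := 1 / 2 + δ / 2) (by linarith) (by linarith))]
        with p hp
      have hp1 : 1 / 2 - ε / 2 < p.2 := hp.1
      have hp2 : p.2 < 1 / 2 + δ / 2 := hp.2
      rcases le_or_gt p.2 (1 / 2) with hq | hq
      · rw [e1 _ _ hq]; exact h5 _ (by linarith) _
      · rw [e2 _ _ hq]; exact k4 _ (by linarith) _
    · refine (t2 (x, t)).congr_of_eventuallyEq ?_
      filter_upwards [hc.preimage_mem_nhds (Ioi_mem_nhds ht)] with p hp
      exact e2 _ _ hp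
  · rcases le_or_gt t (1 / 2) with hq | hq
    · simp only [hq, if_true]; exact h2 _
    · simp only [not_le.2 hq, if_false]; exact k2 _
  · rcases le_or_gt t (1 / 2) with hq | hq
    · simp only [hq, if_true]; exact h3 _ x hx
    · simp only [not_le.2 hq, if_false]; exact k3 _ x hx
  · have a1 := min_le_left (min ε δ / 2) (1 / 4)
    have a2 := min_le_right (min ε δ / 2) (1 / 4)
    have a3 := min_le_left ε δ
    exact (e1 x t (by linarith)).trans (h4 _ (by linarith) x)
  · have a1 := min_le_left (min ε δ / 2) (1 / 4)
    have a2 := min_le_right (min ε δ / 2) (1 / 4)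
    have a3 := min_le_right ε δ
    exact (e2 x t (by linarith)).trans (k5 _ (by linarith) x)

/-- Homotopy through transversal maps, as an equivalence relation. -/
instance homotopySetoid (S : BasedWhitney m X) (n : ℕ) : Setoid (TransversalMap S n) where
  r := Homotopic
  iseqv := ⟨Homotopic.refl, Homotopic.symm, Homotopic.trans⟩

/-- The set `ψₙ(X)`. -/
def Psi (S : BasedWhitney m X) (n : ℕ) : Type _ := Quotient (homotopySetoid S n)

/-- The class `[f]` of a transversal map. -/
def Psi.mk {S : BasedWhitney m X} {n : ℕ} (f : TransversalMap S n) : Psi S n := Quotient.mk _ f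

/-- The constant map to the basepoint. -/
def constMap [IsManifold (𝓡 m) ∞ X] (S : BasedWhitney m X) (n : ℕ) : TransversalMap S n where
  toFun _ := S.pt
  smooth := contMDiff_const
  transversal := by
    intro p A hA hp w
    obtain ⟨B, hB, hpB, hBo⟩ := S.generic
    have hAB : A = B := (S.isWhitney.partition.2 S.pt).unique ⟨hA, hp⟩ ⟨hB, hpB⟩
    subst hAB
    obtain ⟨w, rfl⟩ := Submodule.mkQ_surjective _ w
    refine ⟨0, ?_⟩
    have : w ∈ tangentSubspace (m := m) A S.pt := by
      rw [tangentSubspace_eq_top hBo hp]; trivial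
    simp only [map_zero]
    exact ((Submodule.Quotient.mk_eq_zero _).2 this).symm
  based _ _ := rfl

/-- Transversality at a point depends only on the germ of the map. -/
theorem surjective_congr {n : ℕ} {M : Type*} [TopologicalSpace M]
    [ChartedSpace (EuclideanSpace ℝ (Fin n)) M] {f g : M → X} {p : M} (h : g =ᶠ[𝓝 p] f)
    (A : Set X)
    (hf : Function.Surjective fun v : TangentSpace (𝓡 n) p =>
      (tangentSubspace (m := m) A (f p)).mkQ (mfderiv (𝓡 n) (𝓡 m) f p v)) :
    Function.Surjective fun v : TangentSpace (𝓡 n) p =>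
      (tangentSubspace (m := m) A (g p)).mkQ (mfderiv (𝓡 n) (𝓡 m) g p v) := by
  have key : ∀ F : M → X, (Function.Surjective fun v : TangentSpace (𝓡 n) p =>
      (tangentSubspace (m := m) A (F p)).mkQ (mfderiv (𝓡 n) (𝓡 m) F p v)) ↔
      ∀ w : EuclideanSpace ℝ (Fin m), ∃ v : EuclideanSpace ℝ (Fin n),
        (w - id (α := EuclideanSpace ℝ (Fin m)) (mfderiv (𝓡 n) (𝓡 m) F p v) :
          EuclideanSpace ℝ (Fin m)) ∈
          (tangentSubspace (m := m) A (F p) : Submodule ℝ (EuclideanSpace ℝ (Fin m))) := by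
    intro F
    constructor
    · intro h w
      obtain ⟨v, hv⟩ := h ((tangentSubspace (m := m) A (F p)).mkQ w)
      exact ⟨v, (Submodule.Quotient.eq _).1 hv.symm⟩
    · intro h w
      obtain ⟨w, rfl⟩ := Submodule.mkQ_surjective _ w
      obtain ⟨v, hv⟩ := h w
      exact ⟨v, ((Submodule.Quotient.eq _).2 hv).symm⟩
  rw [key] at hf ⊢
  have h0 : g p = f p := h.eq_of_nhds
  have h1 : (mfderiv (𝓡 n) (𝓡 m) g p : EuclideanSpace ℝ (Fin n) →L[ℝ] EuclideanSpace ℝ (Fin m)) =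
      mfderiv (𝓡 n) (𝓡 m) f p := h.mfderiv_eq
  intro w
  obtain ⟨v, hv⟩ := hf w
  refine ⟨v, ?_⟩
  have h2 := DFunLike.congr_fun h1 v
  rw [h0]
  exact h2 ▸ hv

/-- Precomposition with a diffeomorphism preserves transversality. -/
theorem IsTransversal.comp_diffeo {n : ℕ} {f : Sph n → X} {𝒮 : Set (Set X)}
    (hs : ContMDiff (𝓡 n) (𝓡 m) ∞ f) (hf : IsTransversal n m 𝒮 f) {φ ψ : Sph n → Sph n}
    (hφ : ContMDiff (𝓡 n) (𝓡 n) ∞ φ) (hψ : ContMDiff (𝓡 n) (𝓡 n) ∞ ψ)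
    (h1 : ∀ x, φ (ψ x) = x) (h2 : ∀ x, ψ (φ x) = x) :
    IsTransversal n m 𝒮 fun x => f (φ x) := by
  intro p A hA hp w
  obtain ⟨v, hv⟩ := hf (φ p) A hA hp w
  have d1 : mfderiv (𝓡 n) (𝓡 m) (f ∘ φ) p =
      (mfderiv (𝓡 n) (𝓡 m) f (φ p)).comp (mfderiv (𝓡 n) (𝓡 n) φ p) :=
    mfderiv_comp p (hs.mdifferentiableAt (by simp)) (hφ.mdifferentiableAt (by simp))
  have d2 : mfderiv (𝓡 n) (𝓡 n) (φ ∘ ψ) (φ p) =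
      (mfderiv (𝓡 n) (𝓡 n) φ (ψ (φ p))).comp (mfderiv (𝓡 n) (𝓡 n) ψ (φ p)) :=
    mfderiv_comp (φ p) (hφ.mdifferentiableAt (by simp)) (hψ.mdifferentiableAt (by simp))
  have d3 : φ ∘ ψ = id := funext h1
  rw [d3, mfderiv_id] at d2
  have d4 : ∀ q, q = p → ∀ u : EuclideanSpace ℝ (Fin n),
      (mfderiv (𝓡 n) (𝓡 n) φ q u : EuclideanSpace ℝ (Fin n)) = mfderiv (𝓡 n) (𝓡 n) φ p u := by
    rintro q rfl u; rfl
  refine ⟨(mfderiv (𝓡 n) (𝓡 n) ψ (φ p) v : EuclideanSpace ℝ (Fin n)), ?_⟩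
  have d5 : (mfderiv (𝓡 n) (𝓡 n) φ p
      (mfderiv (𝓡 n) (𝓡 n) ψ (φ p) v : EuclideanSpace ℝ (Fin n)) : EuclideanSpace ℝ (Fin n)) = v :=
    (d4 _ (h2 p) _).symm.trans (DFunLike.congr_fun d2 v).symm
  have d6 := DFunLike.congr_fun d1
    (mfderiv (𝓡 n) (𝓡 n) ψ (φ p) v : EuclideanSpace ℝ (Fin n))
  have d7 : (mfderiv (𝓡 n) (𝓡 m) (fun x => f (φ x)) p
      (mfderiv (𝓡 n) (𝓡 n) ψ (φ p) v : EuclideanSpace ℝ (Fin n)) : EuclideanSpace ℝ (Fin m)) =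
      mfderiv (𝓡 n) (𝓡 m) f (φ p) v :=
    d6.trans (congrArg (mfderiv (𝓡 n) (𝓡 m) f (φ p)) d5)
  exact (congrArg (tangentSubspace (m := m) A (f (φ p))).mkQ d7).trans hv

theorem finrank_fact (n : ℕ) :
    Fact (Module.finrank ℝ (EuclideanSpace ℝ (Fin (n + 1))) = n + 1) := ⟨by simp⟩

theorem contMDiff_coord {n : ℕ} (i : Fin (n + 1)) :
    ContMDiff (𝓡 n) 𝓘(ℝ, ℝ) ∞ fun x : Sph n => x.1 i := by
  have := finrank_fact n
  exact (EuclideanSpace.proj (𝕜 := ℝ) i).contMDiff.comp contMDiff_coe_sphere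

theorem contMDiff_height {n : ℕ} : ContMDiff (𝓡 n) 𝓘(ℝ, ℝ) ∞ (height (n := n)) :=
  contMDiff_coord (Fin.last n)

theorem contMDiff_similarity {n : ℕ} {a c : ℝ} (ha : a ≠ 0) :
    ContMDiff (𝓡 (n + 1)) (𝓡 (n + 1)) ∞ (similarity (n := n) a c ha) := by
  have := finrank_fact (n + 1)
  have h0 := contMDiff_coord (n := n + 1) 0
  have hh := contMDiff_height (n := n + 1)
  have hx : ContMDiff (𝓡 (n + 1)) 𝓘(ℝ, EuclideanSpace ℝ (Fin (n + 2))) ∞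
    fun x : Sph (n + 1) => x.1 := contMDiff_coe_sphere
  have hq : ContMDiff (𝓡 (n + 1)) 𝓘(ℝ, ℝ) ∞ fun x : Sph (n + 1) => 1 - height x :=
    contMDiff_const.sub hh
  have hN : ContMDiff (𝓡 (n + 1)) 𝓘(ℝ, ℝ) ∞ fun x : Sph (n + 1) => simNum a c x :=
    ((contMDiff_const.mul (contMDiff_const.add hh)).add (contMDiff_const.mul h0)).add
      (contMDiff_const.mul hq)
  have hD : ContMDiff (𝓡 (n + 1)) 𝓘(ℝ, ℝ) ∞
      fun x : Sph (n + 1) => (simNum a c x + (1 - height x))⁻¹ :=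
    (hN.add hq).inv₀ fun x => (simNum_pos ha x).ne'
  have h1 : ContMDiff (𝓡 (n + 1)) 𝓘(ℝ, EuclideanSpace ℝ (Fin (n + 2))) ∞
      fun x : Sph (n + 1) => (2 * a) • x.1 := (contMDiff_const (c := 2 * a) (I' := 𝓘(ℝ, ℝ))).smul hx
  have h2 : ContMDiff (𝓡 (n + 1)) 𝓘(ℝ, EuclideanSpace ℝ (Fin (n + 2))) ∞
      fun x : Sph (n + 1) => (2 * c * (1 - height x)) •
        (EuclideanSpace.single 0 1 : EuclideanSpace ℝ (Fin (n + 2))) :=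
    (contMDiff_const.mul hq).smul contMDiff_const
  have h3 : ContMDiff (𝓡 (n + 1)) 𝓘(ℝ, EuclideanSpace ℝ (Fin (n + 2))) ∞
      fun x : Sph (n + 1) => (simNum a c x - (1 - height x) - 2 * a * height x) •
        (EuclideanSpace.single (Fin.last (n + 1)) 1 : EuclideanSpace ℝ (Fin (n + 2))) :=
    ((hN.sub hq).sub (contMDiff_const.mul hh)).smul contMDiff_const
  have hv : ContMDiff (𝓡 (n + 1)) 𝓘(ℝ, EuclideanSpace ℝ (Fin (n + 2))) ∞
      (simVec (n := n) a c) :=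
    hD.smul ((h1.add h2).add h3)
  exact hv.codRestrict_sphere (fun x => by simpa using simVec_norm ha x)

theorem similarity_similarity {n : ℕ} {a c b d : ℝ} (ha : a ≠ 0) (hb : b ≠ 0) (hab : b * a = 1)
    (hcd : b * c + d = 0) (x : Sph (n + 1)) : similarity b d hb (similarity a c ha x) = x := by
  have hD := simNum_pos (c := c) ha x
  set D := simNum a c x + (1 - height x) with hDdef
  have hd : d = -(b * c) := by linarith
  have hb' : b = 1 / a := by field_simp; linarith
  have hl : Fin.last (n + 1) ≠ 0 := by simp [Fin.ext_iff]
  have c0 : (similarity a c ha x).1 0 = D⁻¹ * (2 * a * x.1 0 + 2 * c * (1 - height x)) := by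
    simp [similarity, simVec, hl.symm, ← hDdef]
    ring
  have ch : height (similarity a c ha x) = (simNum a c x - (1 - height x)) / D :=
    height_similarity ha x
  have hq : 1 - height (similarity a c ha x) = 2 * (1 - height x) / D := by
    rw [ch]; field_simp; rw [hDdef]; ring
  have hN : simNum b d (similarity a c ha x) = 2 * (1 + height x) / D := by
    have hp : 1 + height (similarity a c ha x) = 2 * simNum a c x / D := by
      rw [ch]; field_simp; rw [hDdef]; ring
    rw [simNum, hp, hq, c0, hd, hb']
    simp only [simNum]
    field_simp
    ring
  have hND : simNum b d (similarity a c ha x) + (1 - height (similarity a c ha x)) = 4 / D := by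
    rw [hN, hq]; field_simp; ring
  apply Subtype.ext
  ext i
  change simVec b d (similarity a c ha x) i = x.1 i
  have hsim : (similarity a c ha x).1 i = D⁻¹ * (2 * a * x.1 i +
      2 * c * (1 - height x) * (if i = 0 then 1 else 0) +
      (simNum a c x - (1 - height x) - 2 * a * height x) *
        (if i = Fin.last (n + 1) then 1 else 0)) := by
    simp only [similarity, simVec, ← hDdef, PiLp.smul_apply, PiLp.add_apply, smul_eq_mul,
      PiLp.single_apply]
  by_cases hi : i = Fin.last (n + 1)
  · have := height_similarity (c := d) hb (similarity a c ha x)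
    rw [hND, hN, hq] at this
    subst hi
    change height (similarity b d hb (similarity a c ha x)) = height x
    rw [this]; field_simp; ring
  · rw [simVec, hND]
    simp only [PiLp.smul_apply, PiLp.add_apply, smul_eq_mul, PiLp.single_apply, hsim,
      hi, if_false, hq, mul_zero, add_zero]
    rw [hd, hb']
    field_simp
    split_ifs <;> ring

theorem contMDiff_reflect {n : ℕ} :
    ContMDiff (𝓡 (n + 1)) (𝓡 (n + 1)) ∞ (reflect (n := n)) := by
  have := finrank_fact (n + 1)
  have h0 := contMDiff_coord (n := n + 1) 0
  have hx : ContMDiff (𝓡 (n + 1)) 𝓘(ℝ, EuclideanSpace ℝ (Fin (n + 2))) ∞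
    fun x : Sph (n + 1) => x.1 := contMDiff_coe_sphere
  have hv : ContMDiff (𝓡 (n + 1)) 𝓘(ℝ, EuclideanSpace ℝ (Fin (n + 2))) ∞
      (reflectVec (n := n)) := hx.sub ((contMDiff_const.mul h0).smul contMDiff_const)
  exact hv.codRestrict_sphere (fun x => by simpa using reflectVec_norm x)

theorem reflect_reflect {n : ℕ} (x : Sph (n + 1)) : reflect (reflect x) = x := by
  apply Subtype.ext
  ext i
  by_cases hi : i = 0
  · subst hi; simp [reflect, reflectVec]; ring
  · simp [reflect, reflectVec, hi]

theorem height_reflect {n : ℕ} (x : Sph (n + 1)) : height (reflect x) = height x := by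
  have hl : Fin.last (n + 1) ≠ 0 := by simp [Fin.ext_iff]
  simp [height, reflect, reflectVec, hl]

theorem leftLobe_or {n : ℕ} (x : Sph (n + 1)) :
    4 / 5 ≤ height (leftLobe x) ∨ 4 / 5 ≤ height (rightLobe x) := by
  rcases le_total 0 (x.1 0) with h | h
  · exact Or.inl (le_height_similarity (by norm_num) x (by linarith [neg_one_le_height x]))
  · exact Or.inr (le_height_similarity (by norm_num) x (by linarith [neg_one_le_height x]))

theorem lobe_of_mem_cap {n : ℕ} {x : Sph (n + 1)} (hx : x ∈ cap (n + 1)) :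
    leftLobe x ∈ cap (n + 1) ∧ rightLobe x ∈ cap (n + 1) := by
  have hs := sph_sq x
  have h1 := height_le_one x
  have hx' : (3 : ℝ) / 5 ≤ height x := hx
  have habs : |x.1 0| ≤ (1 + height x) / 2 := by
    apply abs_le_of_sq_le_sq _ (by linarith)
    nlinarith
  have h2 := (abs_le.1 habs)
  constructor
  · have := le_height_similarity (c := 3) (by norm_num) x (by linarith [h2.1])
    change (3 : ℝ) / 5 ≤ _
    exact le_trans (by norm_num) this
  · have := le_height_similarity (c := -3) (by norm_num) x (by linarith [h2.2])
    change (3 : ℝ) / 5 ≤ _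
    exact le_trans (by norm_num) this

theorem based_collapse {n : ℕ} {X : Type*} {x₀ : X} {f : Sph n → X} (hf : ∀ x ∈ cap n, f x = x₀)
    (x : Sph n) : f (collapse x) = f x := by
  by_cases h : x ∈ cap n
  · rw [hf _ h, hf _ (collapse_mem_cap h)]
  · rw [collapse_eq_self (le_of_lt (not_le.1 h))]

theorem pole_mem_cap (n : ℕ) : pole n ∈ cap n := by
  change (3 : ℝ) / 5 ≤ (pole n).1 (Fin.last n)
  simp [pole]; norm_num

theorem wedgeMap_pinch_left {n : ℕ} {X : Type*} {x₀ : X} {f g : Sph (n + 1) → X}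
    (hf : ∀ x ∈ cap (n + 1), f x = x₀) (hg : ∀ x ∈ cap (n + 1), g x = x₀) {x : Sph (n + 1)}
    (hx : rightLobe x ∈ cap (n + 1)) : wedgeMap f g (pinch x) = f (leftLobe x) := by
  by_cases h : collapse (rightLobe x) = pole (n + 1)
  · simp only [wedgeMap, pinch, h, if_true]
    exact based_collapse hf _
  · simp only [wedgeMap, pinch, h, if_false]
    have h' := (pinch_mem x).resolve_right h
    rw [based_collapse hg, hg _ hx, ← based_collapse hf, h', hf _ (pole_mem_cap _)]

theorem wedgeMap_pinch_right {n : ℕ} {X : Type*} {x₀ : X} {f g : Sph (n + 1) → X}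
    (hf : ∀ x ∈ cap (n + 1), f x = x₀) (hg : ∀ x ∈ cap (n + 1), g x = x₀) {x : Sph (n + 1)}
    (hx : leftLobe x ∈ cap (n + 1)) : wedgeMap f g (pinch x) = g (rightLobe x) := by
  by_cases h : collapse (rightLobe x) = pole (n + 1)
  · simp only [wedgeMap, pinch, h, if_true]
    rw [based_collapse hf, hf _ hx, ← based_collapse hg, h, hg _ (pole_mem_cap _)]
  · simp only [wedgeMap, pinch, h, if_false]
    exact based_collapse hg _

theorem lobe_near {n : ℕ} (x : Sph (n + 1)) :
    (∀ᶠ y in 𝓝 x, leftLobe y ∈ cap (n + 1)) ∨ (∀ᶠ y in 𝓝 x, rightLobe y ∈ cap (n + 1)) := by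
  have hl : Continuous fun y : Sph (n + 1) => height (leftLobe y) :=
    contMDiff_height.continuous.comp (contMDiff_similarity _).continuous
  have hr : Continuous fun y : Sph (n + 1) => height (rightLobe y) :=
    contMDiff_height.continuous.comp (contMDiff_similarity _).continuous
  rcases leftLobe_or x with h | h
  · left
    filter_upwards [hl.continuousAt.preimage_mem_nhds
      (Ioi_mem_nhds (lt_of_lt_of_le (by norm_num : (3 : ℝ) / 5 < 4 / 5) h))] with y hy
    exact le_of_lt (mem_preimage.1 hy)
  · right
    filter_upwards [hr.continuousAt.preimage_mem_nhds
      (Ioi_mem_nhds (lt_of_lt_of_le (by norm_num : (3 : ℝ) / 5 < 4 / 5) h))] with y hy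
    exact le_of_lt (mem_preimage.1 hy)

theorem contMDiff_pinch {n : ℕ} {x₀ : X} {F G : Sph (n + 1) → ℝ → X}
    (hF : ContMDiff ((𝓡 (n + 1)).prod 𝓘(ℝ, ℝ)) (𝓡 m) ∞ fun p : Sph (n + 1) × ℝ => F p.1 p.2)
    (hG : ContMDiff ((𝓡 (n + 1)).prod 𝓘(ℝ, ℝ)) (𝓡 m) ∞ fun p : Sph (n + 1) × ℝ => G p.1 p.2)
    (hf : ∀ t, ∀ x ∈ cap (n + 1), F x t = x₀) (hg : ∀ t, ∀ x ∈ cap (n + 1), G x t = x₀) :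
    ContMDiff ((𝓡 (n + 1)).prod 𝓘(ℝ, ℝ)) (𝓡 m) ∞ fun p : Sph (n + 1) × ℝ =>
      wedgeMap (fun x => F x p.2) (fun x => G x p.2) (pinch p.1) := by
  have hl : ContMDiff (𝓡 (n + 1)) (𝓡 (n + 1)) ∞ (leftLobe (n := n)) := contMDiff_similarity _
  have hr : ContMDiff (𝓡 (n + 1)) (𝓡 (n + 1)) ∞ (rightLobe (n := n)) := contMDiff_similarity _
  have h1 := hF.comp ((hl.comp contMDiff_fst).prodMk
    (contMDiff_snd (I := 𝓡 (n + 1)) (M := Sph (n + 1)) (J := 𝓘(ℝ, ℝ)) (N := ℝ)))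
  have h2 := hG.comp ((hr.comp contMDiff_fst).prodMk
    (contMDiff_snd (I := 𝓡 (n + 1)) (M := Sph (n + 1)) (J := 𝓘(ℝ, ℝ)) (N := ℝ)))
  rintro ⟨x, t⟩
  have hc : Tendsto (fun p : Sph (n + 1) × ℝ => p.1) (𝓝 (x, t)) (𝓝 x) := continuousAt_fst
  rcases lobe_near x with h | h
  · refine (h2 (x, t)).congr_of_eventuallyEq ?_
    filter_upwards [hc.eventually h] with p hp
    exact wedgeMap_pinch_right (hf p.2) (hg p.2) hp
  · refine (h1 (x, t)).congr_of_eventuallyEq ?_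
    filter_upwards [hc.eventually h] with p hp
    exact wedgeMap_pinch_left (hf p.2) (hg p.2) hp

theorem isTransversal_pinch {n : ℕ} {x₀ : X} {𝒮 : Set (Set X)} {f g : Sph (n + 1) → X}
    (sf : ContMDiff (𝓡 (n + 1)) (𝓡 m) ∞ f) (sg : ContMDiff (𝓡 (n + 1)) (𝓡 m) ∞ g)
    (tf : IsTransversal (n + 1) m 𝒮 f) (tg : IsTransversal (n + 1) m 𝒮 g)
    (hf : ∀ x ∈ cap (n + 1), f x = x₀) (hg : ∀ x ∈ cap (n + 1), g x = x₀) :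
    IsTransversal (n + 1) m 𝒮 fun x => wedgeMap f g (pinch x) := by
  have hl : ContMDiff (𝓡 (n + 1)) (𝓡 (n + 1)) ∞ (leftLobe (n := n)) := contMDiff_similarity _
  have hr : ContMDiff (𝓡 (n + 1)) (𝓡 (n + 1)) ∞ (rightLobe (n := n)) := contMDiff_similarity _
  have t1 : IsTransversal (n + 1) m 𝒮 fun x => f (leftLobe x) :=
    tf.comp_diffeo sf hl (contMDiff_similarity (a := 1 / 3) (c := -1) (by norm_num))
      (similarity_similarity _ _ (by norm_num) (by norm_num))
      (similarity_similarity _ _ (by norm_num) (by norm_num))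
  have t2 : IsTransversal (n + 1) m 𝒮 fun x => g (rightLobe x) :=
    tg.comp_diffeo sg hr (contMDiff_similarity (a := 1 / 3) (c := 1) (by norm_num))
      (similarity_similarity _ _ (by norm_num) (by norm_num))
      (similarity_similarity _ _ (by norm_num) (by norm_num))
  intro p A hA hp
  rcases lobe_near p with h | h
  · have he : (fun x => wedgeMap f g (pinch x)) =ᶠ[𝓝 p] fun x => g (rightLobe x) :=
      h.mono fun y hy => wedgeMap_pinch_right hf hg hy
    exact surjective_congr he A (t2 p A hA ((congrArg (· ∈ A) he.eq_of_nhds).mp hp))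
  · have he : (fun x => wedgeMap f g (pinch x)) =ᶠ[𝓝 p] fun x => f (leftLobe x) :=
      h.mono fun y hy => wedgeMap_pinch_left hf hg hy
    exact surjective_congr he A (t1 p A hA ((congrArg (· ∈ A) he.eq_of_nhds).mp hp))

theorem based_pinch {n : ℕ} {X : Type*} {x₀ : X} {f g : Sph (n + 1) → X}
    (hf : ∀ x ∈ cap (n + 1), f x = x₀) (hg : ∀ x ∈ cap (n + 1), g x = x₀) :
    ∀ x ∈ cap (n + 1), wedgeMap f g (pinch x) = x₀ := fun x hx => by
  rw [wedgeMap_pinch_left hf hg (lobe_of_mem_cap hx).2, hf _ (lobe_of_mem_cap hx).1]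

theorem contMDiff_slice {n : ℕ} {H : Sph n → ℝ → X}
    (h : ContMDiff ((𝓡 n).prod 𝓘(ℝ, ℝ)) (𝓡 m) ∞ fun p : Sph n × ℝ => H p.1 p.2) (t : ℝ) :
    ContMDiff (𝓡 n) (𝓡 m) ∞ fun x => H x t :=
  h.comp (contMDiff_id.prodMk (contMDiff_const (c := t) (I' := 𝓘(ℝ, ℝ))))

/-- The map `(f ∨ g) ∘ μ`. -/
def mulMap {S : BasedWhitney m X} {n : ℕ} (f g : TransversalMap S (n + 1)) :
    TransversalMap S (n + 1) where
  toFun x := wedgeMap f.toFun g.toFun (pinch x)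
  smooth := contMDiff_slice (H := fun x _ => wedgeMap f.toFun g.toFun (pinch x))
    (contMDiff_pinch (F := fun x _ => f.toFun x) (G := fun x _ => g.toFun x)
      (f.smooth.comp contMDiff_fst) (g.smooth.comp contMDiff_fst) (fun _ => f.based)
      (fun _ => g.based)) 0
  transversal := isTransversal_pinch f.smooth g.smooth f.transversal g.transversal f.based g.based
  based := based_pinch f.based g.based

/-- The map `f ∘ ρ`. -/
def daggerMap {S : BasedWhitney m X} {n : ℕ} (f : TransversalMap S (n + 1)) :
    TransversalMap S (n + 1) where
  toFun x := f.toFun (reflect x)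
  smooth := f.smooth.comp contMDiff_reflect
  transversal := f.transversal.comp_diffeo f.smooth contMDiff_reflect contMDiff_reflect
    reflect_reflect reflect_reflect
  based x hx := f.based _ (by rw [cap, mem_ofPred_eq, height_reflect]; exact hx)

theorem Homotopic.mul {S : BasedWhitney m X} {n : ℕ} {f g f' g' : TransversalMap S (n + 1)}
    (hf : Homotopic f f') (hg : Homotopic g g') : Homotopic (mulMap f g) (mulMap f' g') := by
  obtain ⟨H, h1, h2, h3, ε, hε, h4, h5⟩ := hf
  obtain ⟨K, k1, k2, k3, δ, hδ, k4, k5⟩ := hg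
  refine ⟨fun x t => wedgeMap (fun y => H y t) (fun y => K y t) (pinch x),
    contMDiff_pinch h1 k1 h3 k3,
    fun t => isTransversal_pinch (contMDiff_slice h1 t) (contMDiff_slice k1 t) (h2 t) (k2 t) (h3 t)
      (k3 t),
    fun t => based_pinch (x₀ := S.pt) (h3 t) (k3 t), min ε δ, by positivity, fun t ht x => ?_,
    fun t ht x => ?_⟩
  · have e1 : (fun y => H y t) = f.toFun := funext (h4 t (ht.trans_le (min_le_left _ _)))
    have e2 : (fun y => K y t) = g.toFun := funext (k4 t (ht.trans_le (min_le_right _ _)))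
    simp only [e1, e2, mulMap]
  · have e1 : (fun y => H y t) = f'.toFun :=
      funext (h5 t (by have := min_le_left ε δ; linarith))
    have e2 : (fun y => K y t) = g'.toFun :=
      funext (k5 t (by have := min_le_right ε δ; linarith))
    simp only [e1, e2, mulMap]

theorem Homotopic.dagger {S : BasedWhitney m X} {n : ℕ} {f g : TransversalMap S (n + 1)}
    (h : Homotopic f g) : Homotopic (daggerMap f) (daggerMap g) := by
  obtain ⟨H, h1, h2, h3, ε, hε, h4, h5⟩ := h
  refine ⟨fun x t => H (reflect x) t, ?_, fun t => ?_, fun t x hx => ?_, ε, hε,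
    fun t ht x => h4 t ht _, fun t ht x => h5 t ht _⟩
  · exact h1.comp ((contMDiff_reflect.comp contMDiff_fst).prodMk contMDiff_snd)
  · exact (h2 t).comp_diffeo (contMDiff_slice h1 t) contMDiff_reflect contMDiff_reflect
      reflect_reflect reflect_reflect
  · exact h3 t _ (by rw [cap, mem_ofPred_eq, height_reflect]; exact hx)

/-- The unit of `ψₙ(X)`: the class of the constant map. -/
instance [IsManifold (𝓡 m) ∞ X] (S : BasedWhitney m X) (n : ℕ) : One (Psi S (n + 1)) :=
  ⟨Psi.mk (constMap S (n + 1))⟩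

/-- The product of `ψₙ(X)`, `n ≥ 1`: `[f] * [g] = [(f ∨ g) ∘ μ]`. -/
instance (S : BasedWhitney m X) (n : ℕ) : Mul (Psi S (n + 1)) :=
  ⟨Quotient.map₂ mulMap fun _ _ hf _ _ hg => Homotopic.mul hf hg⟩

/-- The anti-involution of `ψₙ(X)`, `n ≥ 1`: `[f]† = [f ∘ ρ]`. -/
def Psi.dagger {S : BasedWhitney m X} {n : ℕ} : Psi S (n + 1) → Psi S (n + 1) :=
  Quotient.map daggerMap fun _ _ h => Homotopic.dagger h

/-- An element of `ψₙ(X)`, `n ≥ 1`, is invertible if it has a two-sided inverse. -/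
def Psi.IsInvertible [IsManifold (𝓡 m) ∞ X] {S : BasedWhitney m X} {n : ℕ}
    (a : Psi S (n + 1)) : Prop := ∃ b, a * b = 1 ∧ b * a = 1

end Psi

end

end TransversalHomotopy

/-!
Let `U` be the open stratum which contains the basepoint.

A homotopy `H` through transversal maps cannot leave or enter `U` in the course of time
(`mem_of_homotopy`). The set of times `t` at which `H (·, t)` meets the complement of `U` is closed,
since the sphere is compact. It is also open: if `H (p, t)` lies in a stratum `A ≠ U`, then
transversality says that, in a chart flattening `A`, the transverse components of `H (·, t)` form a
submersion at `p`, so that the intersection with `A` persists for times near `t`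
(`eventually_exists_mem`). Hence if `[f] [g] = 1`, then `(f ∨ g) ∘ μ` has values in `U`, as the
constant map has, and so do `f` and `g`. Having values in `U` is the same as inducing the trivial
stratification.

For maps into the open set `U`, transversality is automatic, and the usual arguments for homotopy
groups apply. They are carried out in stereographic coordinates, where a based map is a map
`ℝⁿ → X` which is constant outside the ball of radius `2`, and where a smooth family of such maps is
a homotopy (`homotopic_of_planar`). There the product places rescaled copies of `f` and `g` side by
side (`mulMap_unstereo`), and the unit laws (`homotopic_one_mul`, `homotopic_mul_one`) and
associativity (`homotopic_mul_assoc`) come from moving the copies linearly. The product `f† * f` is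
`f` composed with a fold of the space along a hyperplane, and translating the folded image off the
support of `f` deforms it to the constant map (`homotopic_dagger_mul`). So a map into `U` has the
inverse `f†`, and `a b = 1` implies `b = (a† a) b = a† (a b) = a†`.

A non-invertible element is represented by a map from the sphere to the line, stratified into the
origin and the two open half-lines, which has the equator as regular preimage of the origin
(`rampTransversal`).
-/

namespace TransversalHomotopy

noncomputable section

/-! ### Stereographic coordinates -/

/-- Stereographic projection `x ↦ (x₀, …, xₙ₋₁) / (1 - xₙ)` from the basepoint, with junk value `0`
at the basepoint. -/
def stereo {n : ℕ} (x : Sph n) : EuclideanSpace ℝ (Fin n) :=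
  WithLp.toLp 2 fun i => (1 - height x)⁻¹ * x.1 i.castSucc

/-- The vector underlying `unstereo`. -/
def unstereoVec {n : ℕ} (y : EuclideanSpace ℝ (Fin n)) : EuclideanSpace ℝ (Fin (n + 1)) :=
  WithLp.toLp 2 (Fin.snoc (fun i => (‖y‖ ^ 2 + 1)⁻¹ * (2 * y i))
    ((‖y‖ ^ 2 + 1)⁻¹ * (‖y‖ ^ 2 - 1)) : Fin (n + 1) → ℝ)

theorem unstereoVec_norm {n : ℕ} (y : EuclideanSpace ℝ (Fin n)) : ‖unstereoVec y‖ = 1 := by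
  rw [← sq_eq_sq₀ (norm_nonneg _) zero_le_one, EuclideanSpace.real_norm_sq_eq,
    Fin.sum_univ_castSucc]
  simp only [unstereoVec, Fin.snoc_castSucc, Fin.snoc_last, mul_pow, ← Finset.mul_sum,
    ← EuclideanSpace.real_norm_sq_eq]
  have : ‖y‖ ^ 2 + 1 ≠ 0 := by positivity
  field_simp
  ring

/-- The inverse of stereographic projection. -/
def unstereo {n : ℕ} (y : EuclideanSpace ℝ (Fin n)) : Sph n :=
  ⟨unstereoVec y, by simpa using unstereoVec_norm y⟩

theorem height_unstereo {n : ℕ} (y : EuclideanSpace ℝ (Fin n)) :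
    height (unstereo y) = (‖y‖ ^ 2 + 1)⁻¹ * (‖y‖ ^ 2 - 1) := by
  simp [height, unstereo, unstereoVec]

theorem unstereo_castSucc {n : ℕ} (y : EuclideanSpace ℝ (Fin n)) (i : Fin n) :
    (unstereo y).1 i.castSucc = (‖y‖ ^ 2 + 1)⁻¹ * (2 * y i) := by
  simp [unstereo, unstereoVec]

theorem one_sub_height_unstereo {n : ℕ} (y : EuclideanSpace ℝ (Fin n)) :
    1 - height (unstereo y) = 2 * (‖y‖ ^ 2 + 1)⁻¹ := by
  rw [height_unstereo]
  field_simp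
  ring

theorem stereo_unstereo {n : ℕ} (y : EuclideanSpace ℝ (Fin n)) : stereo (unstereo y) = y := by
  ext i
  have : ‖y‖ ^ 2 + 1 ≠ 0 := by positivity
  simp only [stereo, one_sub_height_unstereo, unstereo_castSucc]
  field_simp

theorem height_lt_one {n : ℕ} {x : Sph n} (hx : x ≠ pole n) : height x < 1 := by
  refine (height_le_one x).lt_of_ne fun h => hx ?_
  have hn : ∑ i, (x.1 i) ^ 2 = 1 := by
    rw [← EuclideanSpace.real_norm_sq_eq, sph_norm]; norm_num
  rw [Fin.sum_univ_castSucc] at hn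
  have hl : x.1 (Fin.last n) = 1 := h
  rw [hl, one_pow, add_eq_right,
    Finset.sum_eq_zero_iff_of_nonneg fun i _ => sq_nonneg _] at hn
  apply Subtype.ext
  ext i
  induction i using Fin.lastCases with
  | last => simpa [pole] using hl
  | cast i => simpa [pole, (Fin.castSucc_lt_last i).ne] using hn i (Finset.mem_univ _)

theorem norm_stereo_sq {n : ℕ} {x : Sph n} (hx : x ≠ pole n) :
    ‖stereo x‖ ^ 2 = (1 - height x)⁻¹ * (1 + height x) := by
  have hn : ∑ i, (x.1 i) ^ 2 = 1 := by
    rw [← EuclideanSpace.real_norm_sq_eq, sph_norm]; norm_num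
  rw [Fin.sum_univ_castSucc] at hn
  have hl : x.1 (Fin.last n) = height x := rfl
  rw [hl] at hn
  have h1 : 1 - height x ≠ 0 := by linarith [height_lt_one hx]
  rw [EuclideanSpace.real_norm_sq_eq]
  simp only [stereo, mul_pow, ← Finset.mul_sum]
  rw [eq_sub_of_add_eq hn]
  field_simp
  ring

theorem unstereo_stereo {n : ℕ} {x : Sph n} (hx : x ≠ pole n) : unstereo (stereo x) = x := by
  have h1 : 1 - height x ≠ 0 := by linarith [height_lt_one hx]
  have h2 : ‖stereo x‖ ^ 2 + 1 = 2 * (1 - height x)⁻¹ := by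
    rw [norm_stereo_sq hx]; field_simp; ring
  apply Subtype.ext
  ext i
  induction i using Fin.lastCases with
  | last =>
    change height (unstereo (stereo x)) = height x
    rw [height_unstereo, h2, norm_stereo_sq hx]
    field_simp
    ring
  | cast i =>
    rw [unstereo_castSucc, h2]
    simp only [stereo]
    field_simp

theorem unstereo_ne_pole {n : ℕ} (y : EuclideanSpace ℝ (Fin n)) : unstereo y ≠ pole n := by
  intro h
  have h1 := one_sub_height_unstereo y
  have h2 : height (pole n) = 1 := by simp [height, pole]
  rw [h, h2] at h1
  have : 0 < 2 * (‖y‖ ^ 2 + 1)⁻¹ := by positivity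
  linarith

theorem contMDiff_unstereo {n : ℕ} :
    ContMDiff 𝓘(ℝ, EuclideanSpace ℝ (Fin n)) (𝓡 n) ∞ (unstereo (n := n)) := by
  have := finrank_fact n
  have hpos : ∀ y : EuclideanSpace ℝ (Fin n), ‖y‖ ^ 2 + 1 ≠ 0 := fun y => by positivity
  have hN : ContDiff ℝ ∞ fun y : EuclideanSpace ℝ (Fin n) => ‖y‖ ^ 2 := contDiff_norm_sq ℝ
  have hv : ContDiff ℝ ∞ (unstereoVec (n := n)) := by
    rw [contDiff_euclidean]
    intro i
    induction i using Fin.lastCases with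
    | last =>
      simp only [unstereoVec, Fin.snoc_last]
      exact ((hN.add contDiff_const).inv hpos).mul (hN.sub contDiff_const)
    | cast i =>
      simp only [unstereoVec, Fin.snoc_castSucc]
      exact ((hN.add contDiff_const).inv hpos).mul (by fun_prop)
  exact hv.contMDiff.codRestrict_sphere (fun x => by simpa using unstereoVec_norm x)

theorem contMDiffAt_stereo {n : ℕ} {x : Sph n} (hx : x ≠ pole n) :
    ContMDiffAt (𝓡 n) 𝓘(ℝ, EuclideanSpace ℝ (Fin n)) ∞ (stereo (n := n)) x := by
  have := finrank_fact n
  have h1 : ContMDiffAt (𝓡 n) 𝓘(ℝ, ℝ) ∞ (fun x : Sph n => (1 - height x)⁻¹) x :=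
    (contMDiff_const.sub contMDiff_height).contMDiffAt.inv₀ (by linarith [height_lt_one hx])
  let ι : EuclideanSpace ℝ (Fin (n + 1)) →L[ℝ] EuclideanSpace ℝ (Fin n) :=
    (EuclideanSpace.equiv (Fin n) ℝ).symm.toContinuousLinearMap.comp
      (ContinuousLinearMap.pi fun i => EuclideanSpace.proj (𝕜 := ℝ) i.castSucc)
  have h2 : ContMDiff (𝓡 n) 𝓘(ℝ, EuclideanSpace ℝ (Fin n)) ∞ (fun x : Sph n => ι x.1) :=
    ι.contMDiff.comp contMDiff_coe_sphere
  exact h1.smul h2.contMDiffAt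

theorem mem_cap_iff {n : ℕ} {x : Sph n} (hx : x ≠ pole n) : x ∈ cap n ↔ 2 ≤ ‖stereo x‖ := by
  have h1 : 0 < 1 - height x := by linarith [height_lt_one hx]
  rw [← sq_le_sq₀ zero_le_two (norm_nonneg _), norm_stereo_sq hx, inv_mul_eq_div, le_div_iff₀ h1]
  change (3 : ℝ) / 5 ≤ height x ↔ _
  constructor <;> intro h <;> linarith

theorem unstereo_mem_cap_iff {n : ℕ} {y : EuclideanSpace ℝ (Fin n)} :
    unstereo y ∈ cap n ↔ 2 ≤ ‖y‖ := by
  rw [mem_cap_iff (unstereo_ne_pole y), stereo_unstereo]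

/-- The first basis vector of `ℝⁿ⁺¹`. -/
def e₀ (n : ℕ) : EuclideanSpace ℝ (Fin (n + 1)) := EuclideanSpace.single 0 1

theorem norm_add_smul_e₀_sq {n : ℕ} (a c : ℝ) (y : EuclideanSpace ℝ (Fin (n + 1))) :
    ‖a • y + c • e₀ n‖ ^ 2 = a ^ 2 * ‖y‖ ^ 2 + 2 * a * c * y 0 + c ^ 2 := by
  simp only [EuclideanSpace.real_norm_sq_eq, Fin.sum_univ_succ, e₀]
  simp
  have : ∀ i : Fin n, (a * y i.succ) ^ 2 = a ^ 2 * y i.succ ^ 2 := fun i => mul_pow _ _ _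
  simp only [this, ← Finset.mul_sum]
  ring

theorem similarity_unstereo {n : ℕ} {a c : ℝ} (ha : a ≠ 0) (y : EuclideanSpace ℝ (Fin (n + 1))) :
    similarity a c ha (unstereo y) = unstereo (a • y + c • e₀ n) := by
  have hp : ‖y‖ ^ 2 + 1 ≠ 0 := by positivity
  have hp' : ‖a • y + c • e₀ n‖ ^ 2 + 1 ≠ 0 := by positivity
  have hq := one_sub_height_unstereo y
  have h0 : (unstereo y).1 0 = (‖y‖ ^ 2 + 1)⁻¹ * (2 * y 0) := unstereo_castSucc y 0
  have hN : simNum a c (unstereo y) = 2 * (‖y‖ ^ 2 + 1)⁻¹ * ‖a • y + c • e₀ n‖ ^ 2 := by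
    rw [simNum, hq, h0, norm_add_smul_e₀_sq, height_unstereo]
    field_simp
    ring
  have hD : simNum a c (unstereo y) + (1 - height (unstereo y)) =
      2 * (‖y‖ ^ 2 + 1)⁻¹ * (‖a • y + c • e₀ n‖ ^ 2 + 1) := by
    rw [hN, hq]; ring
  apply Subtype.ext
  ext i
  induction i using Fin.lastCases with
  | last =>
    change height (similarity a c ha (unstereo y)) = height (unstereo _)
    rw [height_similarity, hD, hN, hq, height_unstereo]
    field_simp
  | cast i =>
    rw [unstereo_castSucc]
    change simVec a c (unstereo y) i.castSucc = _
    rw [simVec, hD]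
    simp only [PiLp.smul_apply, PiLp.add_apply, smul_eq_mul, PiLp.single_apply,
      unstereo_castSucc, hq, (Fin.castSucc_lt_last i).ne, if_false, e₀, mul_zero, add_zero,
      Fin.castSucc_eq_zero_iff]
    field_simp

/-- The reflection in the first coordinate. -/
def flip₀ {n : ℕ} (y : EuclideanSpace ℝ (Fin (n + 1))) : EuclideanSpace ℝ (Fin (n + 1)) :=
  y + (-2 * y 0) • e₀ n

theorem reflect_unstereo {n : ℕ} (y : EuclideanSpace ℝ (Fin (n + 1))) :
    reflect (unstereo y) = unstereo (flip₀ y) := by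
  have h : ‖flip₀ y‖ ^ 2 = ‖y‖ ^ 2 := by
    have := norm_add_smul_e₀_sq 1 (-2 * y 0) y
    rw [one_smul] at this
    rw [flip₀, this]; ring
  apply Subtype.ext
  ext i
  induction i using Fin.lastCases with
  | last =>
    change height (reflect (unstereo y)) = height (unstereo _)
    rw [height_reflect, height_unstereo, height_unstereo, h]
  | cast i =>
    rw [unstereo_castSucc, h]
    have h0 : (unstereo y).1 0 = (‖y‖ ^ 2 + 1)⁻¹ * (2 * y 0) := unstereo_castSucc y 0
    simp only [reflect, reflectVec, PiLp.sub_apply, PiLp.smul_apply, smul_eq_mul,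
      PiLp.single_apply, unstereo_castSucc, h0, flip₀, e₀, PiLp.add_apply,
      Fin.castSucc_eq_zero_iff]
    ring

/-! ### Intersections with strata along transversal homotopies -/

section Persistence

variable {m : ℕ} {X : Type*} [TopologicalSpace X] [ChartedSpace (EuclideanSpace ℝ (Fin m)) X]

/-- In a chart which flattens `A` to the subspace `V`, the tangent spaces of `A` are contained in
`V`. -/
theorem mfderiv_tangentSubspace_le [IsManifold (𝓡 m) ∞ X] {A : Set X} {q : X}
    {φ : OpenPartialHomeomorph X (EuclideanSpace ℝ (Fin m))}
    (hφ : MDifferentiableAt (𝓡 m) (𝓡 m) φ q) (hq : q ∈ φ.source)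
    {V : Submodule ℝ (EuclideanSpace ℝ (Fin m))} (hV : ∀ x ∈ φ.source, x ∈ A ↔ φ x ∈ V)
    {w : TangentSpace (𝓡 m) q} (hw : w ∈ tangentSubspace (m := m) A q) :
    (mfderiv (𝓡 m) (𝓡 m) φ q w : EuclideanSpace ℝ (Fin m)) ∈ V := by
  let D : EuclideanSpace ℝ (Fin m) →L[ℝ] EuclideanSpace ℝ (Fin m) := mfderiv (𝓡 m) (𝓡 m) φ q
  suffices tangentSubspace (m := m) A q ≤ V.comap D.toLinearMap from this hw
  refine Submodule.span_le.2 ?_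
  rintro v ⟨γ, ε, hε, hγ, rfl, hA, hv⟩
  change D v ∈ V
  have hI : Ioo (-ε) ε ∈ 𝓝 (0 : ℝ) := Ioo_mem_nhds (by linarith) hε
  have dγ : MDifferentiableAt 𝓘(ℝ, ℝ) (𝓡 m) γ 0 := (hγ.contMDiffAt hI).mdifferentiableAt (by simp)
  have hd : HasDerivAt (φ ∘ γ) (D v) 0 := by
    let G : ℝ →L[ℝ] EuclideanSpace ℝ (Fin m) := mfderiv 𝓘(ℝ, ℝ) (𝓡 m) γ 0
    have h : HasFDerivAt (φ ∘ γ) (D.comp G) 0 := (hφ.hasMFDerivAt.comp (0 : ℝ)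
      dγ.hasMFDerivAt).hasFDerivAt
    have hG : (D.comp G) 1 = D v := congrArg D hv
    rw [← hG]
    exact h.hasDerivAt
  have hev : ∀ᶠ t in 𝓝 (0 : ℝ), φ (γ t) ∈ V := by
    filter_upwards [hI, dγ.continuousAt.preimage_mem_nhds (φ.open_source.mem_nhds hq)] with t h1 h2
    exact (hV _ h2).1 (hA t h1)
  have h0 : HasDerivAt (fun t => Vᗮ.starProjection ((φ ∘ γ) t)) (Vᗮ.starProjection (D v)) 0 :=
    Vᗮ.starProjection.hasFDerivAt.comp_hasDerivAt 0 hd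
  have h1 : (fun t => Vᗮ.starProjection ((φ ∘ γ) t)) =ᶠ[𝓝 0] fun _ => 0 :=
    hev.mono fun t ht => (Submodule.starProjection_apply_eq_zero_iff _).2
      (Submodule.le_orthogonal_orthogonal V ht)
  have h2 := h0.unique
    ((hasDerivAt_const (0 : ℝ) (0 : EuclideanSpace ℝ (Fin m))).congr_of_eventuallyEq h1)
  have h3 := (Submodule.starProjection_apply_eq_zero_iff _).1 h2
  rwa [Submodule.orthogonal_orthogonal] at h3

/-- If `g (·, t₀)` is a submersion at a zero `y`, then `g (·, t)` has a zero for all `t` near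
`t₀`. -/
theorem eventually_exists_zero {E F : Type*} [NormedAddCommGroup E] [NormedSpace ℝ E]
    [CompleteSpace E] [NormedAddCommGroup F] [NormedSpace ℝ F] [CompleteSpace F] {g : E × ℝ → F}
    {y : E} {t₀ : ℝ} (hg : ContDiffAt ℝ 1 g (y, t₀)) (h0 : g (y, t₀) = 0)
    (hs : Function.Surjective (fderiv ℝ (fun z => g (z, t₀)) y)) {s : Set (E × ℝ)}
    (hsn : s ∈ 𝓝 (y, t₀)) : ∀ᶠ t in 𝓝 t₀, ∃ z, (z, t) ∈ s ∧ g (z, t) = 0 := by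
  have hd := hg.hasStrictFDerivAt one_ne_zero
  have hD : fderiv ℝ (fun z => g (z, t₀)) y =
      (fderiv ℝ g (y, t₀)).comp (ContinuousLinearMap.inl ℝ E ℝ) :=
    (HasFDerivAt.comp (f := fun z : E => (z, t₀)) y hd.hasFDerivAt
      (hasFDerivAt_prodMk_left y t₀)).fderiv
  -- `(z, t) ↦ (g (z, t), t)` is open at `(y, t₀)`, and `(0, t)` is near its value there.
  have hG : HasStrictFDerivAt (fun p : E × ℝ => (g p, p.2))
      ((fderiv ℝ g (y, t₀)).prod (ContinuousLinearMap.snd ℝ E ℝ)) (y, t₀) :=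
    hd.prodMk hasStrictFDerivAt_snd
  have hsurj : ((fderiv ℝ g (y, t₀)).prod (ContinuousLinearMap.snd ℝ E ℝ)).range = ⊤ := by
    rw [LinearMap.range_eq_top]
    rintro ⟨w, s⟩
    obtain ⟨v, hv⟩ := hs (w - fderiv ℝ g (y, t₀) (0, s))
    rw [hD] at hv
    refine ⟨(v, s), Prod.ext ?_ rfl⟩
    change fderiv ℝ g (y, t₀) (v, s) = w
    have h1 : ((v, s) : E × ℝ) = (v, 0) + (0, s) := by simp
    rw [h1, map_add]
    exact add_eq_of_eq_sub hv
  have hmap := hG.map_nhds_eq_of_surj hsurj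
  have him : (fun p : E × ℝ => (g p, p.2)) '' s ∈ 𝓝 ((0 : F), t₀) := by
    have := image_mem_map (m := fun p : E × ℝ => (g p, p.2)) hsn
    rw [hmap, h0] at this
    exact this
  have hc : Tendsto (fun t : ℝ => ((0 : F), t)) (𝓝 t₀) (𝓝 ((0 : F), t₀)) :=
    (continuous_const.prodMk continuous_id).tendsto t₀
  filter_upwards [hc him] with t ht
  obtain ⟨⟨z, t'⟩, hz, he⟩ := ht
  obtain ⟨h1, rfl⟩ := Prod.ext_iff.1 he
  exact ⟨z, hz, h1⟩

/-- A transversal intersection with a submanifold persists under small deformations. -/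
theorem eventually_exists_mem [IsManifold (𝓡 m) ∞ X] {n : ℕ} {A : Set X} (hA : IsSubmanifold m A)
    {H : Sph n → ℝ → X}
    (hH : ContMDiff ((𝓡 n).prod 𝓘(ℝ, ℝ)) (𝓡 m) ∞ fun p : Sph n × ℝ => H p.1 p.2)
    {p : Sph n} (hp : p ≠ pole n) {t₀ : ℝ} (hpA : H p t₀ ∈ A)
    (ht : Function.Surjective fun v : TangentSpace (𝓡 n) p =>
      (tangentSubspace (m := m) A (H p t₀)).mkQ (mfderiv (𝓡 n) (𝓡 m) (fun x => H x t₀) p v)) :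
    ∀ᶠ t in 𝓝 t₀, ∃ x, H x t ∈ A := by
  obtain ⟨φ, hφ, hq, V, hV⟩ := hA _ hpA
  have sφ : ContMDiffAt (𝓡 m) (𝓡 m) ∞ φ (H p t₀) :=
    (contMDiffOn_of_mem_maximalAtlas hφ).contMDiffAt (φ.open_source.mem_nhds hq)
  have dφ : MDifferentiableAt (𝓡 m) (𝓡 m) φ (H p t₀) := sφ.mdifferentiableAt (by simp)
  have φd : φ.MDifferentiable (𝓡 m) (𝓡 m) :=
    ⟨(contMDiffOn_of_mem_maximalAtlas hφ).mdifferentiableOn (by simp),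
      (contMDiffOn_symm_of_mem_maximalAtlas hφ).mdifferentiableOn (by simp)⟩
  set y := stereo p
  have hyp : unstereo y = p := unstereo_stereo hp
  let π : EuclideanSpace ℝ (Fin m) →L[ℝ] Vᗮ := Vᗮ.orthogonalProjectionOnto
  have hπ : ∀ w, π w = 0 ↔ w ∈ V := fun w => by
    rw [Submodule.orthogonalProjectionOnto_eq_zero_iff, Submodule.orthogonal_orthogonal]
  let K : EuclideanSpace ℝ (Fin n) × ℝ → X := fun z => H (unstereo z.1) z.2
  have sK : ContMDiff 𝓘(ℝ, EuclideanSpace ℝ (Fin n) × ℝ) (𝓡 m) ∞ K :=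
    hH.comp ((contMDiff_unstereo.comp contDiff_fst.contMDiff).prodMk contDiff_snd.contMDiff)
  have hK0 : K (y, t₀) = H p t₀ := by simp only [K, hyp]
  let g : EuclideanSpace ℝ (Fin n) × ℝ → Vᗮ := fun z => π (φ (K z))
  have sg : ContDiffAt ℝ ∞ g (y, t₀) := by
    rw [← contMDiffAt_iff_contDiffAt]
    refine π.contMDiff.contMDiffAt.comp _ (ContMDiffAt.comp (y, t₀) ?_ sK.contMDiffAt)
    rw [hK0]
    exact sφ
  have hg0 : g (y, t₀) = 0 := by
    rw [hπ, hK0]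
    exact (hV _ hq).1 hpA
  -- Near `p`, the map `π ∘ φ ∘ H (·, t₀)` is `g (·, t₀)` in the coordinates `stereo`.
  have hsurj : Function.Surjective (fderiv ℝ (fun z => g (z, t₀)) y) := by
    intro w
    have dH : MDifferentiableAt (𝓡 n) (𝓡 m) (fun x => H x t₀) p :=
      (contMDiff_slice hH t₀).mdifferentiableAt (by simp)
    have dπ : ∀ z, MDifferentiableAt (𝓡 m) 𝓘(ℝ, Vᗮ) π z := fun z =>
      π.contMDiff.mdifferentiableAt (n := 1) (by simp)
    have dg : MDifferentiableAt 𝓘(ℝ, EuclideanSpace ℝ (Fin n)) 𝓘(ℝ, Vᗮ) (fun z => g (z, t₀))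
        (stereo p) := by
      have : ContDiffAt ℝ ∞ (fun z => g (z, t₀)) y :=
        ContDiffAt.comp (g := g) (f := fun z => (z, t₀)) y sg
          (contDiffAt_id.prodMk contDiffAt_const)
      exact (this.differentiableAt (by simp)).mdifferentiableAt
    have dσ : MDifferentiableAt (𝓡 n) 𝓘(ℝ, EuclideanSpace ℝ (Fin n)) (stereo (n := n)) p :=
      (contMDiffAt_stereo hp).mdifferentiableAt (by simp)
    have e1 : (π ∘ φ) ∘ (fun x => H x t₀) =ᶠ[𝓝 p] (fun z => g (z, t₀)) ∘ stereo := by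
      filter_upwards [isOpen_ne.mem_nhds hp] with x hx
      simp only [Function.comp, g, K, unstereo_stereo hx]
    have e2 : mfderiv (𝓡 n) 𝓘(ℝ, Vᗮ) ((π ∘ φ) ∘ (fun x => H x t₀)) p =
        ((mfderiv (𝓡 m) 𝓘(ℝ, Vᗮ) π (φ (H p t₀))).comp (mfderiv (𝓡 m) (𝓡 m) φ (H p t₀))).comp
          (mfderiv (𝓡 n) (𝓡 m) (fun x => H x t₀) p) := by
      rw [mfderiv_comp p ((dπ _).comp _ dφ) dH, mfderiv_comp _ (dπ _) dφ]
    have e3 : mfderiv (𝓡 n) 𝓘(ℝ, Vᗮ) ((fun z => g (z, t₀)) ∘ stereo) p =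
        (mfderiv 𝓘(ℝ, EuclideanSpace ℝ (Fin n)) 𝓘(ℝ, Vᗮ) (fun z => g (z, t₀)) (stereo p)).comp
          (mfderiv (𝓡 n) 𝓘(ℝ, EuclideanSpace ℝ (Fin n)) stereo p) := mfderiv_comp p dg dσ
    have hπs : Function.Surjective π := fun w => ⟨w, by simp [π]⟩
    obtain ⟨w₁, rfl⟩ := hπs w
    obtain ⟨w₂, hw₂⟩ := φd.mfderiv_surjective hq w₁
    obtain ⟨v, hv⟩ := ht ((tangentSubspace (m := m) A (H p t₀)).mkQ w₂)
    have hw := mfderiv_tangentSubspace_le dφ hq hV ((Submodule.Quotient.eq _).1 hv.symm)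
    rw [map_sub, hw₂] at hw
    have hw' := sub_eq_zero.1 ((map_sub π w₁ _).symm.trans ((hπ _).2 hw))
    refine ⟨mfderiv (𝓡 n) 𝓘(ℝ, EuclideanSpace ℝ (Fin n)) stereo p v, ?_⟩
    have e4 := DFunLike.congr_fun (e2.symm.trans (e1.mfderiv_eq.trans e3)) v
    rw [mfderiv_eq_fderiv, mfderiv_eq_fderiv, π.fderiv] at e4
    exact e4.symm.trans hw'.symm
  have hsn : K ⁻¹' φ.source ∈ 𝓝 (y, t₀) :=
    sK.continuous.continuousAt.preimage_mem_nhds (by rw [hK0]; exact φ.open_source.mem_nhds hq)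
  filter_upwards [eventually_exists_zero (sg.of_le (by simp)) hg0 hsurj hsn] with t ht
  obtain ⟨z, hz, h0⟩ := ht
  exact ⟨unstereo z, (hV _ hz).2 ((hπ _).1 h0)⟩

/-- A homotopy through transversal maps which ends in the open stratum of the basepoint runs inside
this stratum: the times at which it leaves the stratum form an open and closed set. -/
theorem mem_of_homotopy [IsManifold (𝓡 m) ∞ X] {S : BasedWhitney m X} {n : ℕ} {U : Set X}
    (hU : U ∈ S.strata) (hUo : IsOpen U) (hpt : S.pt ∈ U) {f g : TransversalMap S n}
    (h : Homotopic f g) (hg : ∀ x, g.toFun x ∈ U) (x : Sph n) : f.toFun x ∈ U := by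
  obtain ⟨H, h1, h2, h3, ε, hε, h4, h5⟩ := h
  let T : Set ℝ := {t | ∃ x, H x t ∉ U}
  have hclosed : IsClosed T := by
    have : T = Prod.snd '' ((fun p : Sph n × ℝ => H p.1 p.2) ⁻¹' Uᶜ) := by
      ext t
      simp [T]
    rw [this]
    exact isClosedMap_snd_of_compactSpace _ (hUo.isClosed_compl.preimage h1.continuous)
  have hopen : IsOpen T := by
    rw [isOpen_iff_mem_nhds]
    rintro t ⟨p, hp⟩
    obtain ⟨A, ⟨hA, hpA⟩, -⟩ := S.isWhitney.partition.2 (H p t)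
    have hpole : p ≠ pole n := by
      rintro rfl
      exact hp (h3 t _ (pole_mem_cap n) ▸ hpt)
    filter_upwards [eventually_exists_mem (S.isWhitney.submanifold A hA) h1 hpole hpA
      (h2 t p A hA hpA)] with s ⟨x, hx⟩
    refine ⟨x, fun hxU => hp ?_⟩
    rwa [(S.isWhitney.partition.2 (H x s)).unique ⟨hU, hxU⟩ ⟨hA, hx⟩]
  rcases isClopen_iff.1 ⟨hclosed, hopen⟩ with hT | hT
  · by_contra hx
    have : (0 : ℝ) ∈ T := ⟨x, by rwa [h4 0 hε]⟩
    rw [hT] at this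
    exact this
  · have : (1 : ℝ) ∈ T := hT ▸ mem_univ _
    obtain ⟨z, hz⟩ := this
    exact absurd (hg z) (by rwa [h5 1 (by linarith)] at hz)

end Persistence

/-! ### Gluing maps with disjoint supports -/

section Glue

variable {X : Type*} {x₀ a b : X}

/-- The element `a` if it differs from `x₀`, and `b` otherwise. For maps `A` and `B` whose supports
`{A ≠ x₀}` and `{B ≠ x₀}` are disjoint, `p ↦ glue x₀ (A p) (B p)` is `A` on the support of `A` and
`B` elsewhere. -/
def glue (x₀ a b : X) : X :=
  open Classical in if a = x₀ then b else a

theorem glue_of_left (h : a = x₀) : glue x₀ a b = b := if_pos h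

theorem glue_of_right (h : b = x₀) : glue x₀ a b = a := by
  unfold glue
  split_ifs with h'
  · rw [h, h']
  · rfl

theorem glue_mem {U : Set X} (ha : a ∈ U) (hb : b ∈ U) : glue x₀ a b ∈ U := by
  unfold glue
  split_ifs
  · exact hb
  · exact ha

theorem glue_assoc (x₀ a b c : X) : glue x₀ (glue x₀ a b) c = glue x₀ a (glue x₀ b c) := by
  by_cases h : a = x₀
  · rw [glue_of_left h, glue_of_left h]
  · have h' : ∀ d, glue x₀ a d = a := fun d => if_neg h
    rw [h', h', h']

end Glue

/-! ### Homotopies inside an open stratum -/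

section OpenStratum

variable {m : ℕ} {X : Type*} [TopologicalSpace X] [ChartedSpace (EuclideanSpace ℝ (Fin m)) X]

theorem surjective_mkQ_of_isOpen [IsManifold (𝓡 m) ∞ X] {n : ℕ} {M : Type*} [TopologicalSpace M]
    [ChartedSpace (EuclideanSpace ℝ (Fin n)) M] {A : Set X} (hA : IsOpen A) {f : M → X} {p : M}
    (hp : f p ∈ A) : Function.Surjective fun v : TangentSpace (𝓡 n) p =>
      (tangentSubspace (m := m) A (f p)).mkQ (mfderiv (𝓡 n) (𝓡 m) f p v) := by
  intro w
  obtain ⟨w, rfl⟩ := Submodule.mkQ_surjective _ w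
  refine ⟨0, ?_⟩
  have : w ∈ tangentSubspace (m := m) A (f p) := by
    rw [tangentSubspace_eq_top hA hp]; trivial
  simp only [map_zero]
  exact ((Submodule.Quotient.mk_eq_zero _).2 this).symm

/-- `U` is the stratum of the basepoint, and is open. -/
structure IsBaseStratum (S : BasedWhitney m X) (U : Set X) : Prop where
  mem_strata : U ∈ S.strata
  isOpen : IsOpen U
  pt_mem : S.pt ∈ U

theorem IsBaseStratum.eq_of_mem {S : BasedWhitney m X} {U A : Set X} (hU : IsBaseStratum S U)
    (hA : A ∈ S.strata) {q : X} (hqU : q ∈ U) (hqA : q ∈ A) : A = U :=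
  (S.isWhitney.partition.2 q).unique ⟨hA, hqA⟩ ⟨hU.mem_strata, hqU⟩

/-- A smooth deformation inside the open stratum `U` of maps `ℝⁿ → X` with support in the ball of
radius `2` is a homotopy through transversal maps, in stereographic coordinates. -/
theorem homotopic_of_planar [IsManifold (𝓡 m) ∞ X] {S : BasedWhitney m X} {U : Set X}
    (hU : IsBaseStratum S U) {n : ℕ} {f g : TransversalMap S n}
    (F : EuclideanSpace ℝ (Fin n) × ℝ → X)
    (smooth : ∀ y, ∀ t ∈ Icc (0 : ℝ) 1,
      ContMDiffAt 𝓘(ℝ, EuclideanSpace ℝ (Fin n) × ℝ) (𝓡 m) ∞ F (y, t))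
    (mem : ∀ y, ∀ t ∈ Icc (0 : ℝ) 1, F (y, t) ∈ U)
    (based : ∀ y, ∀ t ∈ Icc (0 : ℝ) 1, 2 ≤ ‖y‖ → F (y, t) = S.pt)
    (zero : ∀ y, F (y, 0) = f.toFun (unstereo y)) (one : ∀ y, F (y, 1) = g.toFun (unstereo y)) :
    Homotopic f g := by
  classical
  let s : ℝ → ℝ := fun t => Real.smoothTransition (3 * t - 1)
  have hs : ContDiff ℝ ∞ s := Real.smoothTransition.contDiff.comp (by fun_prop)
  have hsI : ∀ t, s t ∈ Icc (0 : ℝ) 1 := fun t =>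
    ⟨Real.smoothTransition.nonneg _, Real.smoothTransition.le_one _⟩
  let H : Sph n → ℝ → X := fun x t => if x = pole n then S.pt else F (stereo x, s t)
  have hcap : ∀ t, ∀ x ∈ cap n, H x t = S.pt := fun t x hx => by
    by_cases h : x = pole n
    · exact if_pos h
    · exact (if_neg h).trans (based _ _ (hsI t) ((mem_cap_iff h).1 hx))
  have hmem : ∀ t x, H x t ∈ U := fun t x => by
    by_cases h : x = pole n
    · simp only [H, h, if_true]; exact hU.pt_mem
    · simp only [H, h, if_false]; exact mem _ _ (hsI t)
  have hend : ∀ (k : TransversalMap S n) (t : ℝ),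
      (∀ y, F (y, s t) = k.toFun (unstereo y)) → ∀ x, H x t = k.toFun x := fun k t hk x => by
    by_cases h : x = pole n
    · rw [h, hcap t _ (pole_mem_cap n), k.based _ (pole_mem_cap n)]
    · simp only [H, h, if_false]
      rw [hk, unstereo_stereo h]
  refine ⟨H, ?_, fun t p A hA hp => ?_, hcap, 1 / 3, by norm_num, fun t ht => hend f t fun y => ?_,
    fun t ht => hend g t fun y => ?_⟩
  · rintro ⟨x, t⟩
    have hfst : ContinuousAt (fun p : Sph n × ℝ => p.1) (x, t) := continuousAt_fst
    by_cases h : x = pole n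
    · have hx : (3 : ℝ) / 5 < height x := by
        subst h
        have : height (pole n) = 1 := by simp [height, pole]
        rw [this]; norm_num
      refine (contMDiffAt_const (c := S.pt)).congr_of_eventuallyEq ?_
      filter_upwards [hfst.eventually (contMDiff_height.continuous.continuousAt.eventually
        (lt_mem_nhds hx))] with p hp
      exact hcap _ _ (le_of_lt hp)
    · have h1 : ContMDiffAt ((𝓡 n).prod 𝓘(ℝ, ℝ)) 𝓘(ℝ, EuclideanSpace ℝ (Fin n) × ℝ) ∞
          (fun p : Sph n × ℝ => (stereo p.1, s p.2)) (x, t) :=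
        ContMDiffAt.prodMk_space
          (ContMDiffAt.comp (f := Prod.fst) (x, t) (contMDiffAt_stereo h) contMDiffAt_fst)
          (ContMDiffAt.comp (f := Prod.snd) (x, t) hs.contMDiff.contMDiffAt contMDiffAt_snd)
      have h2 : ContMDiffAt ((𝓡 n).prod 𝓘(ℝ, ℝ)) (𝓡 m) ∞
          (fun p : Sph n × ℝ => F (stereo p.1, s p.2)) (x, t) :=
        ContMDiffAt.comp (g := F) (f := fun p : Sph n × ℝ => (stereo p.1, s p.2)) (x, t)
          (smooth (stereo x) (s t) (hsI t)) h1
      refine h2.congr_of_eventuallyEq ?_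
      filter_upwards [hfst.eventually (isOpen_ne.mem_nhds h)] with p hp
      exact if_neg hp
  · have hAU : A = U := hU.eq_of_mem hA (hmem t p) hp
    exact surjective_mkQ_of_isOpen (f := fun x => H x t) (p := p) (hAU ▸ hU.isOpen) hp
  · have : s t = 0 := Real.smoothTransition.zero_of_nonpos (by linarith)
    rw [this, zero]
  · have : s t = 1 := Real.smoothTransition.one_of_one_le (by linarith)
    rw [this, one]

theorem contMDiffAt_glue {E : Type*} [NormedAddCommGroup E] [NormedSpace ℝ E] {x₀ : X}
    {A B : E → X} {p : E} (hA : ContMDiffAt 𝓘(ℝ, E) (𝓡 m) ∞ A p)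
    (hB : ContMDiffAt 𝓘(ℝ, E) (𝓡 m) ∞ B p) (h : (∀ᶠ q in 𝓝 p, A q = x₀) ∨ ∀ᶠ q in 𝓝 p, B q = x₀) :
    ContMDiffAt 𝓘(ℝ, E) (𝓡 m) ∞ (fun q => glue x₀ (A q) (B q)) p := by
  rcases h with h | h
  · exact hB.congr_of_eventuallyEq (h.mono fun q hq => glue_of_left hq)
  · exact hA.congr_of_eventuallyEq (h.mono fun q hq => glue_of_right hq)

/-- In stereographic coordinates, the product `f * g` is `f (3 (y + e₀))` glued to
`g (3 (y - e₀))`. -/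
theorem mulMap_unstereo {S : BasedWhitney m X} {n : ℕ} (f g : TransversalMap S (n + 1))
    (y : EuclideanSpace ℝ (Fin (n + 1))) : (mulMap f g).toFun (unstereo y) =
      glue S.pt (f.toFun (unstereo ((3 : ℝ) • y + (3 : ℝ) • e₀ n)))
        (g.toFun (unstereo ((3 : ℝ) • y + (-3 : ℝ) • e₀ n))) := by
  have hl : leftLobe (unstereo y) = unstereo ((3 : ℝ) • y + (3 : ℝ) • e₀ n) :=
    similarity_unstereo _ y
  have hr : rightLobe (unstereo y) = unstereo ((3 : ℝ) • y + (-3 : ℝ) • e₀ n) :=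
    similarity_unstereo _ y
  change wedgeMap f.toFun g.toFun (pinch (unstereo y)) = _
  rcases leftLobe_or (unstereo y) with h | h
  · have hc : leftLobe (unstereo y) ∈ cap (n + 1) := le_trans (by norm_num) h
    rw [wedgeMap_pinch_right f.based g.based hc, glue_of_left (by rw [← hl]; exact f.based _ hc),
      hr]
  · have hc : rightLobe (unstereo y) ∈ cap (n + 1) := le_trans (by norm_num) h
    rw [wedgeMap_pinch_left f.based g.based hc, glue_of_right (by rw [← hr]; exact g.based _ hc),
      hl]

theorem norm_e₀ (n : ℕ) : ‖e₀ n‖ = 1 := by simp [e₀]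

theorem le_norm_smul_add {n : ℕ} {a : ℝ} (ha : 0 ≤ a) (c : ℝ) (y : EuclideanSpace ℝ (Fin (n + 1))) :
    a * ‖y‖ - |c| ≤ ‖a • y + c • e₀ n‖ := by
  have := norm_sub_le (a • y + c • e₀ n) (c • e₀ n)
  rw [add_sub_cancel_right, norm_smul, norm_smul, norm_e₀, Real.norm_of_nonneg ha,
    Real.norm_eq_abs] at this
  linarith

/-- The balls `‖a y + c e₀‖ ≤ 2` and `‖a' y + c' e₀‖ ≤ 2` are disjoint if the distance of their
centres is larger than the sum of their radii. -/
theorem two_lt_norm_or {n : ℕ} {a a' c c' : ℝ} (ha : 0 < a) (ha' : 0 < a')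
    (h : 2 * (a + a') < c * a' - c' * a) (y : EuclideanSpace ℝ (Fin (n + 1))) :
    2 < ‖a • y + c • e₀ n‖ ∨ 2 < ‖a' • y + c' • e₀ n‖ := by
  by_contra! hc
  have h1 : a' • (a • y + c • e₀ n) - a • (a' • y + c' • e₀ n) = (c * a' - c' * a) • e₀ n := by
    module
  have h2 := norm_sub_le (a' • (a • y + c • e₀ n)) (a • (a' • y + c' • e₀ n))
  rw [h1, norm_smul, norm_smul, norm_smul, norm_e₀, Real.norm_of_nonneg ha.le,
    Real.norm_of_nonneg ha'.le, Real.norm_eq_abs] at h2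
  have h3 := le_abs_self (c * a' - c' * a)
  nlinarith [hc.1, hc.2]

/-- The family `(y, t) ↦ f (a(t) y + c(t) e₀)` in stereographic coordinates. -/
def affinePiece {S : BasedWhitney m X} {n : ℕ} (f : TransversalMap S (n + 1)) (a c : ℝ → ℝ)
    (z : EuclideanSpace ℝ (Fin (n + 1)) × ℝ) : X :=
  f.toFun (unstereo (a z.2 • z.1 + c z.2 • e₀ n))

theorem TransversalMap.unstereo_eq_pt {S : BasedWhitney m X} {n : ℕ} (f : TransversalMap S n)
    {y : EuclideanSpace ℝ (Fin n)} (h : 2 ≤ ‖y‖) : f.toFun (unstereo y) = S.pt :=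
  f.based _ (unstereo_mem_cap_iff.2 h)

theorem contMDiff_affinePiece {S : BasedWhitney m X} {n : ℕ} (f : TransversalMap S (n + 1))
    {a c : ℝ → ℝ} (ha : ContDiff ℝ ∞ a) (hc : ContDiff ℝ ∞ c) :
    ContMDiff 𝓘(ℝ, EuclideanSpace ℝ (Fin (n + 1)) × ℝ) (𝓡 m) ∞ (affinePiece f a c) := by
  have h : ContDiff ℝ ∞ fun z : EuclideanSpace ℝ (Fin (n + 1)) × ℝ =>
      a z.2 • z.1 + c z.2 • e₀ n := by fun_prop
  exact f.smooth.comp (contMDiff_unstereo.comp h.contMDiff)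

theorem eventually_affinePiece_eq_pt {S : BasedWhitney m X} {n : ℕ} (f : TransversalMap S (n + 1))
    {a c : ℝ → ℝ} (ha : Continuous a) (hc : Continuous c)
    {z : EuclideanSpace ℝ (Fin (n + 1)) × ℝ} (h : 2 < ‖a z.2 • z.1 + c z.2 • e₀ n‖) :
    ∀ᶠ q in 𝓝 z, affinePiece f a c q = S.pt := by
  have hcont : Continuous fun z : EuclideanSpace ℝ (Fin (n + 1)) × ℝ =>
      ‖a z.2 • z.1 + c z.2 • e₀ n‖ := by fun_prop
  exact (hcont.continuousAt.eventually (lt_mem_nhds h)).mono fun q hq => f.unstereo_eq_pt hq.le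

/-! ### The group laws in an open stratum -/

section Laws

variable [IsManifold (𝓡 m) ∞ X] {S : BasedWhitney m X} {U : Set X} {n : ℕ}

/-- Rescaling a map into `U` by one of the similarities `y ↦ 3 (y ± e₀)` does not change its
class: `y ↦ (3 - 2 t) y ± 3 (1 - t) e₀` connects the similarity to the identity, and maps the
complement of the ball of radius `2` into itself. -/
theorem homotopic_of_similarity (hU : IsBaseStratum S U) {f g : TransversalMap S (n + 1)}
    (hg : ∀ x, g.toFun x ∈ U) {c : ℝ} (hc : |c| = 3)
    (h : ∀ y, f.toFun (unstereo y) = g.toFun (unstereo ((3 : ℝ) • y + c • e₀ n))) :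
    Homotopic f g := by
  refine homotopic_of_planar hU (affinePiece g (fun t => 3 - 2 * t) fun t => (1 - t) * c)
    (fun y t _ => (contMDiff_affinePiece g (by fun_prop) (by fun_prop)).contMDiffAt)
    (fun y t _ => hg _) (fun y t ht hy => g.unstereo_eq_pt ?_) (fun y => ?_) fun y => ?_
  · refine le_trans ?_ (le_norm_smul_add (by linarith [ht.2]) _ y)
    rw [abs_mul, hc, abs_of_nonneg (by linarith [ht.2])]
    nlinarith [ht.1, ht.2]
  · rw [h]; simp [affinePiece]
  · simp only [affinePiece, sub_self, zero_mul, zero_smul, add_zero]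
    norm_num

theorem homotopic_one_mul (hU : IsBaseStratum S U) (g : TransversalMap S (n + 1))
    (hg : ∀ x, g.toFun x ∈ U) : Homotopic (mulMap (constMap S (n + 1)) g) g :=
  homotopic_of_similarity hU hg (c := -3) (by norm_num) fun y => by
    exact (mulMap_unstereo _ _ y).trans (glue_of_left rfl)

theorem homotopic_mul_one (hU : IsBaseStratum S U) (f : TransversalMap S (n + 1))
    (hf : ∀ x, f.toFun x ∈ U) : Homotopic (mulMap f (constMap S (n + 1))) f :=
  homotopic_of_similarity hU hf (c := 3) (by norm_num) fun y => by
    exact (mulMap_unstereo _ _ y).trans (glue_of_right rfl)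

/-- The triple products `(f * g) * k` and `f * (g * k)` are both glued from rescalings of `f`, `g`
and `k`. The linear interpolation between the two triples of rescalings keeps the three supports
disjoint. -/
theorem homotopic_mul_assoc (hU : IsBaseStratum S U) (f g k : TransversalMap S (n + 1))
    (hf : ∀ x, f.toFun x ∈ U) (hg : ∀ x, g.toFun x ∈ U) (hk : ∀ x, k.toFun x ∈ U) :
    Homotopic (mulMap (mulMap f g) k) (mulMap f (mulMap g k)) := by
  let A := affinePiece f (fun t => 9 - 6 * t) fun t => 12 - 9 * t
  let B := affinePiece g (fun _ => 9) fun t => 6 - 12 * t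
  let C := affinePiece k (fun t => 3 + 6 * t) fun t => -3 - 9 * t
  refine homotopic_of_planar hU (fun z => glue S.pt (glue S.pt (A z) (B z)) (C z))
    (fun y t ht => ?_)
    (fun y t ht => glue_mem (glue_mem (hf _) (hg _)) (hk _)) (fun y t ht hy => ?_) (fun y => ?_)
    fun y => ?_
  · have sA : ContMDiffAt 𝓘(ℝ, EuclideanSpace ℝ (Fin (n + 1)) × ℝ) (𝓡 m) ∞ A (y, t) :=
      (contMDiff_affinePiece f (by fun_prop) (by fun_prop)).contMDiffAt
    have sB : ContMDiffAt 𝓘(ℝ, EuclideanSpace ℝ (Fin (n + 1)) × ℝ) (𝓡 m) ∞ B (y, t) :=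
      (contMDiff_affinePiece g (by fun_prop) (by fun_prop)).contMDiffAt
    have sC : ContMDiffAt 𝓘(ℝ, EuclideanSpace ℝ (Fin (n + 1)) × ℝ) (𝓡 m) ∞ C (y, t) :=
      (contMDiff_affinePiece k (by fun_prop) (by fun_prop)).contMDiffAt
    have tA : 2 < ‖(9 - 6 * t) • y + (12 - 9 * t) • e₀ n‖ → ∀ᶠ q in 𝓝 (y, t), A q = S.pt :=
      fun h => eventually_affinePiece_eq_pt (z := (y, t)) f (by fun_prop) (by fun_prop) h
    have tB : 2 < ‖(9 : ℝ) • y + (6 - 12 * t) • e₀ n‖ → ∀ᶠ q in 𝓝 (y, t), B q = S.pt :=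
      fun h => eventually_affinePiece_eq_pt (z := (y, t)) g (by fun_prop) (by fun_prop) h
    have tC : 2 < ‖(3 + 6 * t) • y + (-3 - 9 * t) • e₀ n‖ → ∀ᶠ q in 𝓝 (y, t), C q = S.pt :=
      fun h => eventually_affinePiece_eq_pt (z := (y, t)) k (by fun_prop) (by fun_prop) h
    obtain ⟨h0, h1⟩ := ht
    have hAB := (two_lt_norm_or (a := 9 - 6 * t) (a' := 9) (c := 12 - 9 * t) (c' := 6 - 12 * t)
      (by linarith) (by norm_num) (by nlinarith) y).imp tA tB
    have hAC := (two_lt_norm_or (a := 9 - 6 * t) (a' := 3 + 6 * t) (c := 12 - 9 * t)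
      (c' := -3 - 9 * t) (by linarith) (by linarith) (by nlinarith) y).imp tA tC
    have hBC := (two_lt_norm_or (a := 9) (a' := 3 + 6 * t) (c := 6 - 12 * t)
      (c' := -3 - 9 * t) (by norm_num) (by linarith) (by nlinarith) y).imp tB tC
    refine contMDiffAt_glue (contMDiffAt_glue sA sB hAB) sC ?_
    rcases hAC with hA | hC
    · rcases hBC with hB | hC
      · left
        filter_upwards [hA, hB] with q hqA hqB
        rw [glue_of_left hqA, hqB]
      · exact Or.inr hC
    · exact Or.inr hC
  · obtain ⟨h0, h1⟩ := ht
    have hA : A (y, t) = S.pt := f.unstereo_eq_pt <| by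
      refine le_trans ?_ (le_norm_smul_add (by linarith) _ y)
      rw [abs_of_nonneg (by linarith)]
      nlinarith
    have hB : B (y, t) = S.pt := g.unstereo_eq_pt <| by
      refine le_trans ?_ (le_norm_smul_add (by norm_num) _ y)
      have : |6 - 12 * t| ≤ 6 := abs_le.2 ⟨by linarith, by linarith⟩
      linarith
    have hC : C (y, t) = S.pt := k.unstereo_eq_pt <| by
      refine le_trans ?_ (le_norm_smul_add (by linarith) _ y)
      rw [abs_of_nonpos (by linarith)]
      nlinarith
    rw [glue_of_right hC, glue_of_right hB, hA]
  · have e1 : (3 : ℝ) • ((3 : ℝ) • y + (3 : ℝ) • e₀ n) + (3 : ℝ) • e₀ n =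
        (9 : ℝ) • y + (12 : ℝ) • e₀ n := by module
    have e2 : (3 : ℝ) • ((3 : ℝ) • y + (3 : ℝ) • e₀ n) + (-3 : ℝ) • e₀ n =
        (9 : ℝ) • y + (6 : ℝ) • e₀ n := by module
    simp only [mulMap_unstereo, e1, e2, A, B, C, affinePiece, mul_zero, sub_zero, add_zero]
  · have e1 : (3 : ℝ) • ((3 : ℝ) • y + (-3 : ℝ) • e₀ n) + (3 : ℝ) • e₀ n =
        (9 : ℝ) • y + (-6 : ℝ) • e₀ n := by module
    have e2 : (3 : ℝ) • ((3 : ℝ) • y + (-3 : ℝ) • e₀ n) + (-3 : ℝ) • e₀ n =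
        (9 : ℝ) • y + (-12 : ℝ) • e₀ n := by module
    have n1 : (9 : ℝ) - 6 = 3 := by norm_num
    have n2 : (12 : ℝ) - 9 = 3 := by norm_num
    have n3 : (6 : ℝ) - 12 = -6 := by norm_num
    have n4 : (3 : ℝ) + 6 = 9 := by norm_num
    have n5 : (-3 : ℝ) - 9 = -12 := by norm_num
    simp only [mulMap_unstereo, e1, e2, A, B, C, affinePiece, mul_one, glue_assoc, n1, n2, n3, n4,
      n5]

/-- A smooth even function which is `|s|` for `|s| ≥ 1 / 3`. -/
def smoothAbs (s : ℝ) : ℝ :=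
  s * (Real.smoothTransition (3 * s) - Real.smoothTransition (-(3 * s)))

theorem contDiff_smoothAbs : ContDiff ℝ ∞ smoothAbs :=
  contDiff_id.mul ((Real.smoothTransition.contDiff.comp (by fun_prop)).sub
    (Real.smoothTransition.contDiff.comp (by fun_prop)))

theorem smoothAbs_of_le {s : ℝ} (h : 1 / 3 ≤ s) : smoothAbs s = s := by
  rw [smoothAbs, Real.smoothTransition.one_of_one_le (by linarith),
    Real.smoothTransition.zero_of_nonpos (by linarith)]
  ring

theorem smoothAbs_of_le_neg {s : ℝ} (h : s ≤ -(1 / 3)) : smoothAbs s = -s := by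
  rw [smoothAbs, Real.smoothTransition.zero_of_nonpos (by linarith),
    Real.smoothTransition.one_of_one_le (by linarith)]
  ring

theorem smoothAbs_nonneg (s : ℝ) : 0 ≤ smoothAbs s := by
  rcases le_total 0 s with h | h
  · rw [smoothAbs, Real.smoothTransition.zero_of_nonpos (x := -(3 * s)) (by linarith), sub_zero]
    exact mul_nonneg h (Real.smoothTransition.nonneg _)
  · rw [smoothAbs, Real.smoothTransition.zero_of_nonpos (x := 3 * s) (by linarith), zero_sub,
      mul_neg, ← neg_mul]
    exact mul_nonneg (by linarith) (Real.smoothTransition.nonneg _)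

theorem smoothAbs_le (s : ℝ) : smoothAbs s ≤ |s| := by
  have h1 : |Real.smoothTransition (3 * s) - Real.smoothTransition (-(3 * s))| ≤ 1 := by
    have a1 := Real.smoothTransition.nonneg (3 * s)
    have a2 := Real.smoothTransition.le_one (3 * s)
    have a3 := Real.smoothTransition.nonneg (-(3 * s))
    have a4 := Real.smoothTransition.le_one (-(3 * s))
    exact abs_le.2 ⟨by linarith, by linarith⟩
  refine (le_abs_self _).trans ?_
  rw [smoothAbs, abs_mul]
  exact mul_le_of_le_one_right (abs_nonneg s) h1

theorem abs_le_norm_smul_add (a c : ℝ) (y : EuclideanSpace ℝ (Fin (n + 1))) :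
    |a * y 0 + c| ≤ ‖a • y + c • e₀ n‖ := by
  have := PiLp.norm_apply_le (a • y + c • e₀ n) 0
  simpa [e₀] using this

theorem flip₀_smul_add (y : EuclideanSpace ℝ (Fin (n + 1))) :
    flip₀ ((3 : ℝ) • y + (3 : ℝ) • e₀ n) = (3 : ℝ) • y + (-6 * y 0 - 3) • e₀ n := by
  have : ((3 : ℝ) • y + (3 : ℝ) • e₀ n) 0 = 3 * y 0 + 3 := by simp [e₀]
  rw [flip₀, this]
  module

/-- The product `f† * f` is `f ∘ (y ↦ (3 |y₀| - 3, 3 y₁, …, 3 yₙ))` in stereographic coordinates,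
where `|·|` may be smoothed near `0` since `f` is constant near the crease. Translating the folded
image along `e₀` moves it off the support of `f`. -/
theorem homotopic_dagger_mul (hU : IsBaseStratum S U) (f : TransversalMap S (n + 1))
    (hf : ∀ x, f.toFun x ∈ U) :
    Homotopic (mulMap (daggerMap f) f) (constMap S (n + 1)) := by
  let shift : EuclideanSpace ℝ (Fin (n + 1)) → ℝ → ℝ :=
    fun y t => 3 * smoothAbs (y 0) - 3 * y 0 - 3 + 5 * t
  have hshift : ContDiff ℝ ∞ fun z : EuclideanSpace ℝ (Fin (n + 1)) × ℝ =>
      (3 : ℝ) • z.1 + shift z.1 z.2 • e₀ n := by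
    have h0 : ContDiff ℝ ∞ fun z : EuclideanSpace ℝ (Fin (n + 1)) × ℝ => z.1 0 := by fun_prop
    have h1 := contDiff_smoothAbs.comp h0
    have h2 : ContDiff ℝ ∞ fun z : EuclideanSpace ℝ (Fin (n + 1)) × ℝ => shift z.1 z.2 :=
      (((contDiff_const.mul h1).sub (contDiff_const.mul h0)).sub contDiff_const).add
        (contDiff_const.mul contDiff_snd)
    fun_prop
  have hco : ∀ y t, 2 ≤ |3 * smoothAbs (y 0) - 3 + 5 * t| →
      2 ≤ ‖(3 : ℝ) • y + shift y t • e₀ n‖ := fun y t h => by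
    refine h.trans (le_trans (le_of_eq ?_) (abs_le_norm_smul_add _ _ y))
    congr 1
    simp only [shift]
    ring
  refine homotopic_of_planar hU
    (fun z => f.toFun (unstereo ((3 : ℝ) • z.1 + shift z.1 z.2 • e₀ n)))
    (fun y t _ => (f.smooth.comp (contMDiff_unstereo.comp hshift.contMDiff)).contMDiffAt)
    (fun y t _ => hf _) (fun y t ht hy => f.unstereo_eq_pt ?_) (fun y => ?_)
    fun y => f.unstereo_eq_pt (hco y 1 ?_)
  · have hfar : ∀ s : ℝ, 5 / 3 ≤ s → smoothAbs (y 0) = s →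
        2 ≤ ‖(3 : ℝ) • y + shift y t • e₀ n‖ := fun s hs he =>
      hco y t (le_trans (by rw [he]; linarith [ht.1]) (le_abs_self _))
    rcases le_total (5 / 3) (y 0) with h1 | h1
    · exact hfar _ h1 (smoothAbs_of_le (by linarith))
    rcases le_total (y 0) (-(5 / 3)) with h2 | h2
    · exact hfar _ (by linarith) (smoothAbs_of_le_neg (by linarith))
    -- the coordinates other than `y₀` have norm at least `√11 / 3`
    rw [← sq_le_sq₀ zero_le_two (norm_nonneg _), norm_add_smul_e₀_sq]
    nlinarith [sq_nonneg (3 * y 0 + shift y t)]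
  · rw [mulMap_unstereo]
    have hd : (daggerMap f).toFun (unstereo ((3 : ℝ) • y + (3 : ℝ) • e₀ n)) =
        f.toFun (unstereo ((3 : ℝ) • y + (-6 * y 0 - 3) • e₀ n)) := by
      rw [← flip₀_smul_add, ← reflect_unstereo]
      rfl
    have hl : -(1 / 3) ≤ y 0 →
        (daggerMap f).toFun (unstereo ((3 : ℝ) • y + (3 : ℝ) • e₀ n)) = S.pt := fun h => by
      refine (daggerMap f).unstereo_eq_pt (le_trans ?_ (abs_le_norm_smul_add _ _ y))
      exact le_trans (by linarith) (le_abs_self _)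
    have hr : y 0 ≤ 1 / 3 → f.toFun (unstereo ((3 : ℝ) • y + (-3 : ℝ) • e₀ n)) = S.pt :=
      fun h => by
      refine f.unstereo_eq_pt (le_trans ?_ (abs_le_norm_smul_add _ _ y))
      exact le_trans (by linarith) (neg_le_abs _)
    rcases le_total (1 / 3) (y 0) with h1 | h1
    · have : shift y 0 = -3 := by simp only [shift, smoothAbs_of_le h1]; ring
      rw [glue_of_left (hl (by linarith)), this]
    · rw [glue_of_right (hr h1)]
      rcases le_total (y 0) (-(1 / 3)) with h2 | h2
      · have : shift y 0 = -6 * y 0 - 3 := by simp only [shift, smoothAbs_of_le_neg h2]; ring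
        rw [hd, this]
      · rw [hl h2]
        have : smoothAbs (y 0) ≤ 1 / 3 := (smoothAbs_le _).trans (abs_le.2 ⟨h2, h1⟩)
        exact f.unstereo_eq_pt (hco y 0 (le_trans (by linarith) (neg_le_abs _)))
  · exact le_trans (by linarith [smoothAbs_nonneg (y 0)]) (le_abs_self _)

end Laws

end OpenStratum

/-! ### Invertible elements -/

section Invertible

variable {m : ℕ} {X : Type*} [TopologicalSpace X] [ChartedSpace (EuclideanSpace ℝ (Fin m)) X]
  {S : BasedWhitney m X} {U : Set X} {n : ℕ}

theorem isTrivialStratification_iff (hU : IsBaseStratum S U) (f : TransversalMap S n) :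
    IsTrivialStratification (inducedStratification S.strata f.toFun) ↔ ∀ x, f.toFun x ∈ U := by
  have hpole : f.toFun (pole n) ∈ U := by
    rw [f.based _ (pole_mem_cap n)]
    exact hU.pt_mem
  constructor
  · intro h x
    have hmem : f.toFun ⁻¹' U ∈ inducedStratification S.strata f.toFun :=
      ⟨⟨_, hpole⟩, U, hU.mem_strata, rfl⟩
    rw [IsTrivialStratification] at h
    rw [h, mem_singleton_iff] at hmem
    exact hmem.ge (mem_univ x)
  · intro h
    have hpre : f.toFun ⁻¹' U = univ := eq_univ_of_forall h
    refine Set.ext fun C => ⟨?_, ?_⟩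
    · rintro ⟨⟨x, hx⟩, A, hA, rfl⟩
      rw [hU.eq_of_mem hA (h x) hx, hpre]
      rfl
    · rintro rfl
      exact ⟨⟨pole n, trivial⟩, U, hU.mem_strata, hpre.symm⟩

/-- Both factors of a product occur in it, up to a diffeomorphism. -/
theorem mem_of_mulMap_mem (hU : IsBaseStratum S U) {f g : TransversalMap S (n + 1)}
    (h : ∀ x, (mulMap f g).toFun x ∈ U) : (∀ x, f.toFun x ∈ U) ∧ ∀ x, g.toFun x ∈ U := by
  constructor
  · intro y
    set x := similarity (1 / 3) (-1) (by norm_num) y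
    have hx : leftLobe x = y := similarity_similarity _ _ (by norm_num) (by norm_num) y
    rcases leftLobe_or x with h1 | h1
    · rw [hx] at h1
      rw [f.based y (le_trans (by norm_num) h1)]
      exact hU.pt_mem
    · have := h x
      rw [← hx, ← wedgeMap_pinch_left f.based g.based (le_trans (by norm_num) h1)]
      exact this
  · intro y
    set x := similarity (1 / 3) 1 (by norm_num) y
    have hx : rightLobe x = y := similarity_similarity _ _ (by norm_num) (by norm_num) y
    rcases leftLobe_or x with h1 | h1
    · have := h x
      rw [← hx, ← wedgeMap_pinch_right f.based g.based (le_trans (by norm_num) h1)]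
      exact this
    · rw [hx] at h1
      rw [g.based y (le_trans (by norm_num) h1)]
      exact hU.pt_mem

theorem Psi.mk_eq_iff {f g : TransversalMap S n} : Psi.mk f = Psi.mk g ↔ Homotopic f g :=
  Quotient.eq

theorem Psi.dagger_mk (f : TransversalMap S (n + 1)) :
    (Psi.mk f).dagger = Psi.mk (daggerMap f) := rfl

theorem daggerMap_daggerMap (f : TransversalMap S (n + 1)) : daggerMap (daggerMap f) = f := by
  cases f
  simp [daggerMap, reflect_reflect]

variable [IsManifold (𝓡 m) ∞ X]

/-- The factors of the unit are represented by maps into the open stratum. -/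
theorem mem_of_mul_eq_one (hU : IsBaseStratum S U) {f g : TransversalMap S (n + 1)}
    (h : Psi.mk f * Psi.mk g = 1) : (∀ x, f.toFun x ∈ U) ∧ ∀ x, g.toFun x ∈ U :=
  mem_of_mulMap_mem hU (mem_of_homotopy hU.mem_strata hU.isOpen hU.pt_mem
    (Psi.mk_eq_iff.1 h) fun _ => hU.pt_mem)

theorem Psi.dagger_mul_self (hU : IsBaseStratum S U) {f : TransversalMap S (n + 1)}
    (hf : ∀ x, f.toFun x ∈ U) : (Psi.mk f).dagger * Psi.mk f = 1 :=
  Psi.mk_eq_iff.2 (homotopic_dagger_mul hU f hf)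

theorem Psi.mul_dagger_self (hU : IsBaseStratum S U) {f : TransversalMap S (n + 1)}
    (hf : ∀ x, f.toFun x ∈ U) : Psi.mk f * (Psi.mk f).dagger = 1 := by
  have := Psi.dagger_mul_self hU (f := daggerMap f) fun x => hf _
  rwa [Psi.dagger_mk, daggerMap_daggerMap] at this

/-- `b = 1 b = (a† a) b = a† (a b) = a† 1 = a†`, where all maps have values in the open stratum. -/
theorem Psi.eq_dagger_of_mul_eq_one (hU : IsBaseStratum S U) {a b : Psi S (n + 1)}
    (h : a * b = 1) : b = a.dagger := by
  obtain ⟨f, rfl⟩ := Quotient.exists_rep a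
  obtain ⟨g, rfl⟩ := Quotient.exists_rep b
  change Psi.mk f * Psi.mk g = 1 at h
  change Psi.mk g = (Psi.mk f).dagger
  obtain ⟨hf, hg⟩ := mem_of_mul_eq_one hU h
  have hd : ∀ x, (daggerMap f).toFun x ∈ U := fun x => hf _
  calc Psi.mk g = 1 * Psi.mk g := (Psi.mk_eq_iff.2 (homotopic_one_mul hU g hg)).symm
    _ = (Psi.mk (daggerMap f) * Psi.mk f) * Psi.mk g := by
      rw [← Psi.dagger_mk, Psi.dagger_mul_self hU hf]
    _ = Psi.mk (daggerMap f) * (Psi.mk f * Psi.mk g) :=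
      Psi.mk_eq_iff.2 (homotopic_mul_assoc hU _ f g hd hf hg)
    _ = Psi.mk (daggerMap f) * 1 := by rw [h]
    _ = Psi.mk (daggerMap f) := Psi.mk_eq_iff.2 (homotopic_mul_one hU _ hd)

theorem Psi.isInvertible_mk_iff (hU : IsBaseStratum S U) (f : TransversalMap S (n + 1)) :
    (Psi.mk f).IsInvertible ↔ ∀ x, f.toFun x ∈ U := by
  constructor
  · rintro ⟨b, hb, -⟩
    obtain ⟨g, rfl⟩ := Quotient.exists_rep b
    exact (mem_of_mul_eq_one hU hb).1
  · intro hf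
    exact ⟨_, Psi.mul_dagger_self hU hf, Psi.dagger_mul_self hU hf⟩

end Invertible

/-! ### The line stratified by signs -/

section Line

/-- The line `ℝ¹`. -/
abbrev Line : Type := EuclideanSpace ℝ (Fin 1)

/-- The points of the line with a given sign: an open half-line or the origin. -/
def signStratum (s : SignType) : Set Line := {y | SignType.sign (y 0) = s}

theorem continuous_line_coord : Continuous fun y : Line => y 0 := by fun_prop

theorem isOpen_signStratum {s : SignType} (hs : s ≠ 0) : IsOpen (signStratum s) := by
  cases s with
  | zero => exact absurd rfl hs
  | pos =>
    have : signStratum SignType.pos = {y : Line | 0 < y 0} := Set.ext fun y => sign_eq_one_iff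
    rw [this]
    exact isOpen_lt continuous_const continuous_line_coord
  | neg =>
    have : signStratum SignType.neg = {y : Line | y 0 < 0} := Set.ext fun y => sign_eq_neg_one_iff
    rw [this]
    exact isOpen_lt continuous_line_coord continuous_const

theorem signStratum_zero : signStratum 0 = {0} := by
  ext y
  change SignType.sign (y 0) = 0 ↔ y = 0
  rw [sign_eq_zero_iff]
  refine ⟨fun h => ?_, fun h => by rw [h]; rfl⟩
  ext i
  rw [Subsingleton.elim i 0]
  exact h

theorem smul_e₀_mem_signStratum (c : ℝ) : c • e₀ 0 ∈ signStratum (SignType.sign c) := by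
  simp [signStratum, e₀]

theorem e₀_mem_signStratum_one : e₀ 0 ∈ signStratum 1 := by
  simpa using smul_e₀_mem_signStratum 1

theorem isConnected_signStratum (s : SignType) : IsConnected (signStratum s) := by
  refine ⟨⟨(s : ℝ) • e₀ 0, ?_⟩, Convex.isPreconnected ?_⟩
  · have := smul_e₀_mem_signStratum (s : ℝ)
    rwa [show SignType.sign (s : ℝ) = s by cases s <;> simp] at this
  · have hlin : IsLinearMap ℝ fun y : Line => y 0 := ⟨fun _ _ => rfl, fun _ _ => rfl⟩
    cases s with
    | zero => exact signStratum_zero ▸ convex_singleton (0 : Line)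
    | pos =>
      have : signStratum SignType.pos = {y : Line | 0 < y 0} := Set.ext fun y => sign_eq_one_iff
      rw [this]
      exact convex_halfSpace_gt hlin 0
    | neg =>
      have : signStratum SignType.neg = {y : Line | y 0 < 0} :=
        Set.ext fun y => sign_eq_neg_one_iff
      rw [this]
      exact convex_halfSpace_lt hlin 0

theorem signStratum_unique {s t : SignType} {y : Line} (hs : y ∈ signStratum s)
    (ht : y ∈ signStratum t) : s = t := hs.symm.trans ht

theorem tangentInChart_of_isOpen {A : Set Line} (hA : IsOpen A) {x y : Line} (hy : y ∈ A) :
    tangentInChart (m := 1) A x y = ⊤ := by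
  rw [tangentInChart, tangentSubspace_eq_top hA hy, eq_top_iff]
  intro v _
  refine ⟨v, trivial, ?_⟩
  have h1 : (extChartAt (𝓡 1) x : Line → Line) = id := by
    simp only [extChartAt, chartAt_self_eq, mfld_simps]
  have h2 : mfderiv (𝓡 1) (𝓡 1) (extChartAt (𝓡 1) x) y = mfderiv (𝓡 1) (𝓡 1) (@id Line) y := by
    rw [h1]
  change mfderiv (𝓡 1) (𝓡 1) (extChartAt (𝓡 1) x) y v = v
  rw [h2, mfderiv_id]
  rfl

theorem eq_of_subspaceTendsto_const {m : ℕ} {V P : Submodule ℝ (EuclideanSpace ℝ (Fin m))}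
    (h : SubspaceTendsto (fun _ => V) P) : P = V :=
  Submodule.starProjection_inj.1 (tendsto_nhds_unique h tendsto_const_nhds)

/-- Whitney's condition B is vacuous if the larger stratum is the origin, which has no secants, and
clear if it is a half-line, whose tangent spaces are the whole line. -/
theorem isWhitneyStratification_sign : IsWhitneyStratification 1 (range signStratum) where
  partition := by
    refine ⟨fun ⟨s, hs⟩ => (isConnected_signStratum s).nonempty.ne_empty hs, fun y =>
      ⟨signStratum (SignType.sign (y 0)), ⟨mem_range_self _, rfl⟩, ?_⟩⟩
    rintro _ ⟨⟨s, rfl⟩, hs⟩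
    rw [signStratum_unique hs rfl]
  locallyFinite := by
    have := (finite_range signStratum).to_subtype
    exact locallyFinite_of_finite _
  frontier := by
    rintro _ ⟨s, rfl⟩ _ ⟨t, rfl⟩ ⟨y, hs, ht⟩
    by_cases h0 : s = 0
    · subst h0
      rw [signStratum_zero, mem_singleton_iff] at hs
      rw [signStratum_zero, singleton_subset_iff, ← hs]
      exact ht
    · obtain ⟨z, hz, hz'⟩ := mem_closure_iff.1 ht _ (isOpen_signStratum h0) hs
      rw [signStratum_unique hz hz']
      exact subset_closure
  connected := by
    rintro _ ⟨s, rfl⟩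
    exact isConnected_signStratum s
  locallyClosed := by
    rintro _ ⟨s, rfl⟩
    by_cases h0 : s = 0
    · rw [h0, signStratum_zero]
      exact isClosed_singleton.isLocallyClosed
    · exact (isOpen_signStratum h0).isLocallyClosed
  submanifold := by
    rintro _ ⟨s, rfl⟩ p hp
    by_cases h0 : s = 0
    · refine ⟨chartAt _ p, IsManifold.chart_mem_maximalAtlas p, mem_chart_source _ p, ⊥,
        fun x _ => ?_⟩
      rw [h0, signStratum_zero, chartAt_self_eq]
      rfl
    · have ho := isOpen_signStratum h0
      refine ⟨(chartAt _ p).restr (signStratum s),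
        restr_mem_maximalAtlas _ (IsManifold.chart_mem_maximalAtlas p) ho, ?_, ⊤, fun x hx => ?_⟩
      · simpa [ho.interior_eq] using hp
      · have : x ∈ signStratum s := by
          rw [OpenPartialHomeomorph.restr_source, ho.interior_eq] at hx
          exact hx.2
        simpa using this
  whitneyB := by
    rintro A - _ ⟨t, rfl⟩ hAt x - a b ha hb - - L P hL hsec htan
    by_cases h0 : t = 0
    · -- both sequences are constantly `0`, so that the secants are `⊥`, and have no limit line
      exfalso
      rw [h0, signStratum_zero, closure_singleton] at hAt
      rw [h0, signStratum_zero] at hb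
      have hzero : ∀ k, secantInChart (m := 1) x (a k) (b k) = ⊥ := fun k => by
        have hab : a k = b k := (hAt (ha k)).trans (hb k).symm
        simp only [secantInChart, hab, sub_self, Submodule.span_zero_singleton]
      simp only [hzero] at hsec
      rw [eq_of_subspaceTendsto_const hsec] at hL
      simp at hL
    · have htop : ∀ k, tangentInChart (m := 1) (signStratum t) x (b k) = ⊤ := fun k =>
        tangentInChart_of_isOpen (isOpen_signStratum h0) (hb k)
      simp only [htop] at htan
      rw [eq_of_subspaceTendsto_const htan]
      exact le_top

/-- The line, stratified by signs and based at `1`. -/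
def signLine : BasedWhitney 1 Line where
  strata := range signStratum
  isWhitney := isWhitneyStratification_sign
  pt := e₀ 0
  generic := ⟨signStratum 1, mem_range_self _, e₀_mem_signStratum_one,
    isOpen_signStratum (by decide)⟩

theorem isBaseStratum_signStratum_one : IsBaseStratum signLine (signStratum 1) where
  mem_strata := mem_range_self _
  isOpen := isOpen_signStratum (by decide)
  pt_mem := e₀_mem_signStratum_one

/-- A smooth function which is the identity near `0`, vanishes only at `0` and is `1` on
`[3 / 5, ∞)`. -/
def ramp (h : ℝ) : ℝ := h + (1 - h) * Real.smoothTransition (5 * h - 2)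

theorem contDiff_ramp : ContDiff ℝ ∞ ramp :=
  contDiff_id.add ((contDiff_const.sub contDiff_id).mul
    (Real.smoothTransition.contDiff.comp (by fun_prop)))

theorem ramp_of_le {h : ℝ} (hh : h ≤ 2 / 5) : ramp h = h := by
  rw [ramp, Real.smoothTransition.zero_of_nonpos (by linarith)]
  ring

theorem ramp_of_ge {h : ℝ} (hh : 3 / 5 ≤ h) : ramp h = 1 := by
  rw [ramp, Real.smoothTransition.one_of_one_le (by linarith)]
  ring

theorem ramp_eq_zero {h : ℝ} (hh : ramp h = 0) : h = 0 := by
  rcases le_total h (2 / 5) with h1 | h1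
  · rwa [ramp_of_le h1] at hh
  · exfalso
    rcases le_total (3 / 5) h with h2 | h2
    · rw [ramp_of_ge h2] at hh
      exact one_ne_zero hh
    · rw [ramp] at hh
      have := mul_nonneg (by linarith : 0 ≤ 1 - h) (Real.smoothTransition.nonneg (5 * h - 2))
      linarith

/-- The function `ramp ∘ height` on the sphere, as a map to the line. -/
def rampMap {n : ℕ} (x : Sph n) : Line := ramp (height x) • e₀ 0

theorem contMDiff_rampMap {n : ℕ} : ContMDiff (𝓡 n) (𝓡 1) ∞ (rampMap (n := n)) :=
  (contDiff_ramp.contMDiff.comp contMDiff_height).smul contMDiff_const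

/-- The equator consists of regular points of `rampMap`: along the meridian
`r ↦ unstereo (r • stereo p)` the map is `r ↦ (r² - 1) / (r² + 1)`, with derivative `1` at
`r = 1`. -/
theorem mfderiv_rampMap_surjective {n : ℕ} {p : Sph n} (hp : height p = 0) :
    Function.Surjective (mfderiv (𝓡 n) (𝓡 1) rampMap p) := by
  have hpole : p ≠ pole n := by
    rintro rfl
    have : height (pole n) = 1 := by simp [height, pole]
    rw [hp] at this
    exact zero_ne_one this
  set u := stereo p with hu
  have hu1 : ‖u‖ ^ 2 = 1 := by rw [norm_stereo_sq hpole, hp]; norm_num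
  let γ : ℝ → Sph n := fun r => unstereo (r • u)
  have hγ1 : γ 1 = p := by simp only [γ, one_smul, hu, unstereo_stereo hpole]
  have sγ : ContMDiff 𝓘(ℝ, ℝ) (𝓡 n) ∞ γ :=
    contMDiff_unstereo.comp (ContDiff.contMDiff (by fun_prop))
  have hh : ∀ r, height (γ r) = (r ^ 2 + 1)⁻¹ * (r ^ 2 - 1) := fun r => by
    simp only [γ, height_unstereo, norm_smul, mul_pow, hu1, Real.norm_eq_abs, sq_abs, mul_one]
  have hd : HasDerivAt (fun r => height (γ r)) 1 1 := by
    have h1 : HasDerivAt (fun r : ℝ => r ^ 2) 2 1 := by simpa using hasDerivAt_pow 2 (1 : ℝ)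
    have h2 := ((h1.add_const 1).fun_inv (by norm_num)).fun_mul (h1.sub_const 1)
    rw [funext hh]
    exact h2.congr_deriv (by norm_num)
  have hcomp : HasDerivAt (rampMap ∘ γ) (e₀ 0) 1 := by
    have h1 := hd.smul_const (e₀ 0)
    rw [one_smul] at h1
    refine h1.congr_of_eventuallyEq ?_
    have h0 : height (γ 1) < 2 / 5 := by rw [hγ1, hp]; norm_num
    filter_upwards [hd.continuousAt.eventually (gt_mem_nhds h0)] with r hr
    simp only [Function.comp, rampMap, ramp_of_le hr.le]
  have hchain : mfderiv 𝓘(ℝ, ℝ) (𝓡 1) (rampMap ∘ γ) 1 =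
      (mfderiv (𝓡 n) (𝓡 1) rampMap (γ 1)).comp (mfderiv 𝓘(ℝ, ℝ) (𝓡 n) γ 1) :=
    mfderiv_comp (1 : ℝ) (contMDiff_rampMap.mdifferentiableAt (by simp))
      (sγ.mdifferentiableAt (by simp))
  let D : EuclideanSpace ℝ (Fin n) →L[ℝ] Line := mfderiv (𝓡 n) (𝓡 1) rampMap p
  let v : EuclideanSpace ℝ (Fin n) := mfderiv 𝓘(ℝ, ℝ) (𝓡 n) γ 1 (1 : ℝ)
  have hv : D v = e₀ 0 := by
    have h1 := DFunLike.congr_fun hchain (1 : ℝ)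
    rw [mfderiv_eq_fderiv] at h1
    have h2 : ∀ q, q = p → (mfderiv (𝓡 n) (𝓡 1) rampMap q : EuclideanSpace ℝ (Fin n) →L[ℝ] Line) =
        D := by
      rintro q rfl; rfl
    exact ((DFunLike.congr_fun (h2 _ hγ1) v).symm.trans h1.symm).trans hcomp.deriv
  intro (w : Line)
  refine ⟨(w 0) • v, ?_⟩
  change D (w 0 • v) = w
  rw [map_smul, hv]
  ext i
  rw [Subsingleton.elim i 0]
  simp [e₀]

/-- The transversal map `rampMap` to the line stratified by signs. -/
def rampTransversal (n : ℕ) : TransversalMap signLine n where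
  toFun := rampMap
  smooth := contMDiff_rampMap
  transversal := by
    rintro p _ ⟨s, rfl⟩ hp
    by_cases h0 : s = 0
    · refine (Submodule.mkQ_surjective _).comp (mfderiv_rampMap_surjective (ramp_eq_zero ?_))
      have h1 := smul_e₀_mem_signStratum (ramp (height p))
      exact sign_eq_zero_iff.1 ((signStratum_unique h1 hp).trans h0)
    · exact surjective_mkQ_of_isOpen (isOpen_signStratum h0) hp
  based x hx := by
    rw [rampMap, ramp_of_ge hx, one_smul]
    rfl

theorem exists_rampMap_eq_zero (n : ℕ) : ∃ x : Sph (n + 1), rampMap x = 0 := by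
  refine ⟨unstereo (e₀ n), ?_⟩
  have : height (unstereo (e₀ n)) = 0 := by rw [height_unstereo, norm_e₀]; norm_num
  rw [rampMap, this, ramp_of_le (by norm_num), zero_smul]

end Line

end

end TransversalHomotopy

theorem mainTheorem5 (n : ℕ) :
    (∀ {m : ℕ} {X : Type*} [TopologicalSpace X] [T2Space X] [SecondCountableTopology X]
      [ChartedSpace (EuclideanSpace ℝ (Fin m)) X] [IsManifold (𝓡 m) ∞ X]
      (S : TransversalHomotopy.BasedWhitney m X),
      (∀ f : TransversalHomotopy.TransversalMap S (n + 1),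
        (TransversalHomotopy.Psi.mk f).IsInvertible ↔
          TransversalHomotopy.IsTrivialStratification
            (TransversalHomotopy.inducedStratification S.strata f.toFun)) ∧
      (∀ a b : TransversalHomotopy.Psi S (n + 1), a * b = 1 → b = a.dagger) ∧
      (∀ a : TransversalHomotopy.Psi S (n + 1), a.IsInvertible →
        a * a.dagger = 1 ∧ a.dagger * a = 1)) ∧
    (∃ (m : ℕ) (X : Type) (_ : TopologicalSpace X) (_ : T2Space X) (_ : SecondCountableTopology X)
      (_ : ChartedSpace (EuclideanSpace ℝ (Fin m)) X) (_ : IsManifold (𝓡 m) ∞ X)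
      (S : TransversalHomotopy.BasedWhitney m X) (a : TransversalHomotopy.Psi S (n + 1)),
      ¬ a.IsInvertible) := by
  refine ⟨fun {m X} _ _ _ _ _ S => ?_, 1, TransversalHomotopy.Line, inferInstance, inferInstance,
    inferInstance, inferInstance, inferInstance, TransversalHomotopy.signLine,
    TransversalHomotopy.Psi.mk (TransversalHomotopy.rampTransversal (n + 1)), fun h => ?_⟩
  · obtain ⟨U, hUS, hpt, hUo⟩ := S.generic
    have hU : TransversalHomotopy.IsBaseStratum S U := ⟨hUS, hUo, hpt⟩
    refine ⟨fun f => ?_, fun a b => TransversalHomotopy.Psi.eq_dagger_of_mul_eq_one hU,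
      fun a ha => ?_⟩
    · rw [TransversalHomotopy.Psi.isInvertible_mk_iff hU,
        TransversalHomotopy.isTrivialStratification_iff hU]
    · obtain ⟨f, rfl⟩ := Quotient.exists_rep a
      have hf := (TransversalHomotopy.Psi.isInvertible_mk_iff hU f).1 ha
      exact ⟨TransversalHomotopy.Psi.mul_dagger_self hU hf,
        TransversalHomotopy.Psi.dagger_mul_self hU hf⟩
  · -- the map takes the value `0`, which does not lie in the stratum of the basepoint
    rw [TransversalHomotopy.Psi.isInvertible_mk_iff
      TransversalHomotopy.isBaseStratum_signStratum_one] at h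
    obtain ⟨x, hx⟩ := TransversalHomotopy.exists_rampMap_eq_zero n
    have h0 : (0 : TransversalHomotopy.Line) ∈ TransversalHomotopy.signStratum 0 := by
      rw [TransversalHomotopy.signStratum_zero]; rfl
    have h1 : (0 : TransversalHomotopy.Line) ∈ TransversalHomotopy.signStratum 1 := hx ▸ h x
    exact absurd (TransversalHomotopy.signStratum_unique h0 h1) (by decide)
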